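/- Let $\mathcal Q$ be the algebra of quasisymmetric functions over $\mathbb Q$ in $x_1,x_2,\dots$. For $S=\{i_1<\dots<i_k\}\subseteq[n]=\{1,\dots,n\}$, $n\ge 0$, let $M_S=M_S^{(n+1)}$ be the monomial quasisymmetric function of the composition $(i_1,i_2-i_1,\dots,i_k-i_{k-1},n+1-i_k)$ of $n+1$. Call $S\subseteq[n]$ left sparse if $1\notin S$ and $i\in S$ implies $i-1\notin S$, and right sparse if $n\notin S$ and $i\in S$ implies $i+1\notin S$. Put $\Theta_S=\sum_{T\subseteq[n],\,S\subseteq T\cup(T+1)}2^{|T|+1}M_T$ for left sparse $S\subseteq[n]$; the peak algebra $\Pi\subseteq\mathcal Q$ is the unital subalgebra generated by all these $\Theta_S$. For a word $w=c^{n_1}dc^{n_2}d\cdots c^{n_k}dc^m$ of degree $n$ (with $\deg c=1$, $\deg d=2$) let $|w|_d=k$, let $S_w\subseteq[n]$ be the set of the numbers $\deg(c^{n_1}d\cdots c^{n_j}d)$, $1\le j\le k$, and put $\Theta_w=\Theta_{S_w}$, which is homogeneous of degree $n+1$. For $F\in\mathcal Q$ let $f_S$ be the coefficient of $M_S^{(n+1)}$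 in $F$, and define $h_S,k_S$ by $f_S=\sum_{T\subseteq S}h_T$, $h_S=\sum_{T\subseteq S}k_T$. The coefficients $[w]=[w]_F$ of the $cd$-index of $F$ are the solution of the equations, for all $n\ge0$ and all right sparse $S\subseteq[n]$, $$k_S=\sum [w]\quad\text{over the } w \text{ with } \deg w=n,\ |w|_d=|S|,\ S_w\cap\{i,i+1\}\ne\emptyset \text{ for all } i\in S,$$ and $[[w]]=[w]/2^{|w|_d}$ are the coefficients of its $c$-$2d$-index. (1) The $\Theta_w$, $w$ any $cd$-word, are linearly independent elements of $\Pi$. For every $F\in\Pi$ the coefficients $[w]_F$ exist and are unique, and if $F$ has no constant term, then only finitely many of them are nonzero and $$F=\frac12\sum_w[[w]]\,\Theta_w .$$ (2) Let $P$ be an Eulerian poset of rank $n+1\ge1$ (a finite graded poset with $\hat0$ and $\hat1$, rank function $r$, and $\mu(x,y)=(-1)^{r(y)-r(x)}$ for $x\le y$). Let $f_S(P)$ be the number of chains of $P$ whose elements have precisely the ranks in $S\subseteq[n]$, let $F(P)=\sum_{S\subseteq[n]}f_S(P)M_S$, and define $h_S(P)$ by $f_S(P)=\sum_{T\subseteq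 S}h_T(P)$. There is a unique polynomial $\psi_P\in\mathbb Z\langle c,d\rangle$, the $cd$-index of $P$, with $\psi_P(a+b,ab+ba)=\sum_{S\subseteq[n]}h_S(P)\,u_1\cdots u_n$, where $u_i=b$ if $i\in S$ and $u_i=a$ if $i\notin S$; and if $[w]_P$ is the coefficient of $w$ in $\psi_P$, then $$F(P)=\sum_w\frac{[w]_P}{2^{|w|_d+1}}\,\Theta_w .$$ -/

import Mathlib

open Finset

namespace PeakCD

noncomputable section

/-! Quasisymmetric functions are formal power series over `ℚ` in `x 0, x 1, x 2, …`.
Subsets of `[n] = {1, …, n}` are finsets `S ⊆ Finset.Icc 1 n`. -/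

/-- The successive differences of `p, i₁, i₂, …`. -/
def diffs : ℕ → List ℕ → List ℕ
  | _, [] => []
  | p, i :: l => (i - p) :: diffs i l

/-- The composition `β(S) = (i₁, i₂ - i₁, …, iₖ - iₖ₋₁, n + 1 - iₖ)` of `n + 1` attached to a
subset `S = {i₁ < ⋯ < iₖ}` of `[n]`. -/
def comp (n : ℕ) (S : Finset ℕ) : List ℕ := diffs 0 (S.sort ++ [n + 1])

/-- The list of the nonzero exponents of a monomial, in the order of the variables. -/
def exponents (m : ℕ →₀ ℕ) : List ℕ := m.support.sort.map m

/-- The monomial quasisymmetric function `∑ x_{i₁}^{β₁} ⋯ x_{iₖ}^{βₖ}` over `i₁ < ⋯ < iₖ`,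
for a composition `β` (a list of positive integers). -/
def monomialQSym (β : List ℕ) : MvPowerSeries ℕ ℚ :=
  fun m => if exponents m = β then 1 else 0

/-- `M_S = M_S^{(n+1)}` for `S ⊆ [n]`. -/
def M (n : ℕ) (S : Finset ℕ) : MvPowerSeries ℕ ℚ := monomialQSym (comp n S)

/-- `S` is a left sparse subset of `[n]`: `1 ∉ S`, and `S` has no two consecutive elements. -/
def LeftSparse (n : ℕ) (S : Finset ℕ) : Prop :=
  S ⊆ Icc 1 n ∧ 1 ∉ S ∧ ∀ i ∈ S, i - 1 ∉ S

/-- `S` is a right sparse subset of `[n]`: `n ∉ S`, and `S` has no two consecutive elements. -/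
def RightSparse (n : ℕ) (S : Finset ℕ) : Prop :=
  S ⊆ Icc 1 n ∧ n ∉ S ∧ ∀ i ∈ S, i + 1 ∉ S

/-- `Θ_S = ∑ 2 ^ (|T| + 1) M_T`, over the `T ⊆ [n]` with `S ⊆ T ∪ (T + 1)`. -/
def thetaSet (n : ℕ) (S : Finset ℕ) : MvPowerSeries ℕ ℚ :=
  ∑ T ∈ (Icc 1 n).powerset with S ⊆ T ∪ T.image (· + 1), (2 : ℚ) ^ (#T + 1) • M n T

/-- The peak algebra `Π`: the (unital) subalgebra generated by the `Θ_S`,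
`S ⊆ [n]` left sparse, `n ≥ 0`. -/
def peakAlgebra : Subalgebra ℚ (MvPowerSeries ℕ ℚ) :=
  Algebra.adjoin ℚ {F | ∃ n S, LeftSparse n S ∧ F = thetaSet n S}

/-- The two letters of `cd`-words. -/
inductive CD
  | c
  | d
  deriving DecidableEq

/-- A `cd`-word. -/
abbrev CDWord := FreeMonoid CD

/-- The degree of a letter: `c` has degree 1 and `d` has degree 2. -/
def CD.deg : CD → ℕ
  | .c => 1
  | .d => 2

/-- The degree of a `cd`-word. -/
def deg (w : CDWord) : ℕ := (w.toList.map CD.deg).sum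

/-- `|w|_d`, the number of letters `d` in `w`. -/
def dDeg (w : CDWord) : ℕ := w.toList.count CD.d

/-- The numbers `p + deg (u d)`, for the prefixes of the form `u d` of the given word. -/
def dEnds : ℕ → List CD → Finset ℕ
  | _, [] => ∅
  | p, .c :: l => dEnds (p + 1) l
  | p, .d :: l => insert (p + 2) (dEnds (p + 2) l)

/-- The subset `S_w = {i₁, …, iₖ}` of `[deg w]`, for `w = c^{n₁} d ⋯ c^{nₖ} d c^m`,
where `iⱼ = deg (c^{n₁} d ⋯ c^{nⱼ} d)`. -/
def wordSet (w : CDWord) : Finset ℕ := dEnds 0 w.toList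

/-- The element `Θ_w = Θ_{S_w}`, homogeneous of degree `deg w + 1`. -/
def theta (w : CDWord) : MvPowerSeries ℕ ℚ := thetaSet (deg w) (wordSet w)

/-- The coefficient `f_S` of `M_S = M_S^{(n+1)}` in a quasisymmetric function `F`, which is the
coefficient of `x 0 ^ β₁ * x 1 ^ β₂ * ⋯` with `β = β(S)`. -/
def flagF (F : MvPowerSeries ℕ ℚ) (n : ℕ) (S : Finset ℕ) : ℚ :=
  MvPowerSeries.coeff (comp n S).toFinsupp F

/-- Möbius inversion on finite subsets: `g = moebius f` is the function determined by
`f S = ∑ T ⊆ S, g T`. -/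
def moebius {R : Type*} [Ring R] (f : Finset ℕ → R) (S : Finset ℕ) : R :=
  ∑ T ∈ S.powerset, (-1) ^ (#S - #T) * f T

/-- The coefficient `h_S` of `F`, determined by `f_S = ∑ T ⊆ S, h_T`. -/
def flagH (F : MvPowerSeries ℕ ℚ) (n : ℕ) : Finset ℕ → ℚ := moebius (flagF F n)

/-- The coefficient `k_S` of `F`, determined by `h_S = ∑ T ⊆ S, k_T`. -/
def flagK (F : MvPowerSeries ℕ ℚ) (n : ℕ) : Finset ℕ → ℚ := moebius (flagH F n)

/-- `T` meets every member of the family `I`, that is, `T` is in the blocking family of `I`. -/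
def Blocks (I : Finset (Finset ℕ)) (T : Finset ℕ) : Prop := ∀ A ∈ I, (T ∩ A).Nonempty

/-- The family `{i, i + 1}`, `i ∈ S`. -/
def intervals (S : Finset ℕ) : Finset (Finset ℕ) := S.image fun i => {i, i + 1}

/-- `κ w = [w]_F` for all `cd`-words `w`, that is, `κ` is the family of the coefficients of the
`cd`-index of `F`: for all `n`, the coefficients `k_S`, `S ⊆ [n]` right sparse, of the homogeneous
component of degree `n + 1` of `F` are `k_S = ∑ [w]`, over the words `w` of degree `n`
with `|w|_d = |S|` such that `S_w` blocks the `{i, i + 1}`, `i ∈ S`. -/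
def IsCDIndex (F : MvPowerSeries ℕ ℚ) (κ : CDWord → ℚ) : Prop :=
  ∀ n S, RightSparse n S → flagK F n S =
    ∑ᶠ w ∈ {w : CDWord | deg w = n ∧ dDeg w = #S ∧ Blocks (intervals S) (wordSet w)}, κ w

/-- The coefficients `[[w]] = [w] / 2 ^ |w|_d` of the `c`-`2d`-index, in terms of the
coefficients `[w]` of the `cd`-index. -/
def c2dCoeff (κ : CDWord → ℚ) (w : CDWord) : ℚ := κ w / 2 ^ dDeg w

section Poset

variable (P : Type*) [PartialOrder P] [BoundedOrder P] [GradeMinOrder ℕ P]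

/-- A graded poset is Eulerian if `μ(x, y) = (-1) ^ (r(y) - r(x))` whenever `x ≤ y`. -/
def IsEulerian [LocallyFiniteOrder P] [DecidableEq P] : Prop :=
  ∀ x y : P, x ≤ y → IncidenceAlgebra.mu ℤ x y = (-1) ^ (grade ℕ y - grade ℕ x)

/-- `f_S(P)`, the number of chains of `P` whose elements have precisely the ranks in `S`. -/
def posetFlagF (S : Finset ℕ) : ℤ :=
  (Set.ncard {C : Finset P | IsChain (· ≤ ·) (C : Set P) ∧ C.image (grade ℕ) = S} : ℤ)

/-- `h_S(P)`, determined by `f_S(P) = ∑ T ⊆ S, h_T(P)`. -/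
def posetFlagH : Finset ℕ → ℤ := moebius (posetFlagF P)

/-- `F(P) = ∑ f_S(P) M_S`, over the `S ⊆ [n]`, for a graded poset `P` of rank `n + 1`. -/
def posetQSym (n : ℕ) : MvPowerSeries ℕ ℚ :=
  ∑ S ∈ (Icc 1 n).powerset, (posetFlagF P S : ℚ) • M n S

/-- The two letters of `ab`-words. -/
inductive AB
  | a
  | b
  deriving DecidableEq

/-- The noncommutative polynomial `a` or `b`. -/
def AB.poly (x : AB) : MonoidAlgebra ℤ (FreeMonoid AB) :=
  MonoidAlgebra.of ℤ (FreeMonoid AB) (FreeMonoid.of x)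

/-- The `ab`-word `u₁ ⋯ uₙ` with `uᵢ = b` if `i ∈ S`, and `uᵢ = a` if `i ∉ S`. -/
def abWord (n : ℕ) (S : Finset ℕ) : FreeMonoid AB :=
  FreeMonoid.ofList ((List.range n).map fun i => if i + 1 ∈ S then AB.b else AB.a)

/-- The `ab`-index `∑ h_S(P) u_S`, over the `S ⊆ [n]`, of a graded poset `P` of rank `n + 1`. -/
def abIndex (n : ℕ) : MonoidAlgebra ℤ (FreeMonoid AB) :=
  ∑ S ∈ (Icc 1 n).powerset,
    posetFlagH P S • MonoidAlgebra.of ℤ (FreeMonoid AB) (abWord n S)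

/-- The substitution `c = a + b`, `d = ab + ba`. -/
def cdToAB : MonoidAlgebra ℤ CDWord →ₐ[ℤ] MonoidAlgebra ℤ (FreeMonoid AB) :=
  MonoidAlgebra.lift ℤ _ _ (FreeMonoid.lift fun
    | .c => AB.a.poly + AB.b.poly
    | .d => AB.a.poly * AB.b.poly + AB.b.poly * AB.a.poly)

/-- `ψ` is the `cd`-index of the graded poset `P` of rank `n + 1`: the polynomial in the
noncommuting variables `c`, `d` that becomes the `ab`-index for `c = a + b`, `d = ab + ba`. -/
def IsPosetCDIndex (n : ℕ) (ψ : MonoidAlgebra ℤ CDWord) : Prop :=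
  cdToAB ψ = abIndex P n

end Poset

end

end PeakCD

open PeakCD

namespace PeakCD

/-! Everything rests on the generalized Dehn–Sommerville relations for the coefficients `f_S`. For
quasisymmetric `F` they say precisely that the substitution `x (p + 1) = - x p` has the same effect
as `x p = x (p + 1) = 0`, for every `p` (`mem_cancelling_iff`). In this form they cut out an
equalizer of algebra homomorphisms, hence a subalgebra, so it is enough to check them for the
generators `Θ_S` (`LeftSparse.dehnSommerville_coverCount`), and they hold on the whole peak algebra
(`peakAlgebra_le`). For Eulerian posets they follow from the vanishing alternating rank sums of
intervals (`IsEulerian.dehnSommerville`).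

A solution of the relations in degree `n + 1` is determined by its values on right sparse sets
(`DehnSommerville.eq_zero`). On the other hand every `cd`-word `w` of degree `n` yields a solution:
with `X = S_w`, let `h_S` be 1 if `S` contains exactly one of `x - 1`, `x` for each `x ∈ X`, and 0
otherwise. Multiplied by `2 ^ |w|_d`, its `f`-vector is half that of `Θ_w`
(`two_pow_mul_sum_xorInd`, `flagF_thetaSet`). On right sparse sets its `k`-vector is the 0-1 matrix
of the equations defining the `cd`-index (`sum_blockInd`).

This matrix is unitriangular: a right sparse `S` is matched with the word whose set is `S + 1`, and
any other word with a nonzero entry at `S` has a smaller sum of elements (`sum_lt_sum_of_blocks`).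
So the equations have a unique solution `κ`, over `ℤ` as well as over `ℚ`, and comparing values on
right sparse sets shows that `f` is the combination of the word solutions with coefficients `κ`
(`DehnSommerville.exists_isFlagF`). This gives the expansion in the `Θ_w` and their independence.
For posets, the `h`-vector of `w` is also the coefficient vector of `w(a + b, ab + ba)`
(`cdToAB_of`), so `κ` is the ordinary `cd`-index. -/

/-! ### Compositions of `n + 1` and subsets of `[n]` -/

/-- The partial sums of `p, b₁, b₂, …`, without the initial term `p`. -/
def cuts : ℕ → List ℕ → Finset ℕ
  | _, [] => ∅
  | p, b :: l => insert (p + b) (cuts (p + b) l)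

theorem cuts_append (p : ℕ) (α γ : List ℕ) :
    cuts p (α ++ γ) = cuts p α ∪ cuts (p + α.sum) γ := by
  induction α generalizing p with
  | nil => simp [cuts]
  | cons b l ih => simp [cuts, ih, add_assoc]

theorem lt_of_mem_cuts {p x : ℕ} {β : List ℕ} (hβ : ∀ b ∈ β, 0 < b) (hx : x ∈ cuts p β) :
    p < x ∧ x ≤ p + β.sum := by
  induction β generalizing p with
  | nil => simp [cuts] at hx
  | cons b l ih =>
    simp only [List.mem_cons, forall_eq_or_imp] at hβ
    simp only [cuts, mem_insert] at hx
    simp only [List.sum_cons]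
    rcases hx with rfl | hx
    · omega
    · have := ih hβ.2 hx
      omega

theorem add_sum_mem_cuts {p : ℕ} {β : List ℕ} (hβ : β ≠ []) : p + β.sum ∈ cuts p β := by
  induction β generalizing p with
  | nil => simp at hβ
  | cons b l ih =>
    by_cases hl : l = []
    · simp [hl, cuts]
    · have := ih (p := p + b) hl
      simp [cuts, ← add_assoc, this]

theorem diffs_sort_cuts {p : ℕ} {β : List ℕ} (hβ : ∀ b ∈ β, 0 < b) :
    diffs p (cuts p β).sort = β := by
  induction β generalizing p with
  | nil => simp [cuts, diffs]
  | cons b l ih =>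
    simp only [List.mem_cons, forall_eq_or_imp] at hβ
    rw [cuts, sort_insert]
    · simp [diffs, ih hβ.2]
    · intro x hx
      exact (lt_of_mem_cuts hβ.2 hx).1.le
    · intro hx
      exact absurd (lt_of_mem_cuts hβ.2 hx).1 (lt_irrefl _)

theorem cuts_diffs {p : ℕ} {l : List ℕ} (hl : l.Pairwise (· < ·)) (hp : ∀ x ∈ l, p < x) :
    cuts p (diffs p l) = l.toFinset := by
  induction l generalizing p with
  | nil => simp [cuts, diffs]
  | cons b l ih =>
    have hb : p + (b - p) = b := Nat.add_sub_cancel' (hp b (by simp)).le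
    rw [List.pairwise_cons] at hl
    simp [cuts, diffs, hb, ih hl.2 hl.1]

theorem diffs_pos {p : ℕ} {l : List ℕ} (hl : l.Pairwise (· < ·)) (hp : ∀ x ∈ l, p < x) :
    ∀ b ∈ diffs p l, 0 < b := by
  induction l generalizing p with
  | nil => simp [diffs]
  | cons b l ih =>
    rw [List.pairwise_cons] at hl
    simp only [diffs, List.mem_cons, forall_eq_or_imp]
    exact ⟨Nat.sub_pos_of_lt (hp b (by simp)), ih hl.2 hl.1⟩

theorem comp_eq_diffs_sort {n : ℕ} {T : Finset ℕ} (hT : T ⊆ Icc 1 n) :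
    comp n T = diffs 0 (insert (n + 1) T).sort := by
  rw [comp]
  congr 1
  have hn : ∀ x ∈ T, x < n + 1 := fun x hx => Nat.lt_succ_of_le (mem_Icc.1 (hT hx)).2
  refine List.Perm.eq_of_pairwise (le := (· ≤ ·)) (fun a b _ _ h h' => le_antisymm h h') ?_
    (Finset.pairwise_sort _ _) ?_
  · rw [List.pairwise_append]
    refine ⟨Finset.pairwise_sort _ _, by simp, ?_⟩
    intro a ha b hb
    rw [List.mem_singleton] at hb
    rw [hb]
    exact (hn a (by simpa using ha)).le
  · have hnT : n + 1 ∉ T := fun h => lt_irrefl _ (hn _ h)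
    refine (List.perm_ext_iff_of_nodup ?_ (Finset.sort_nodup _ _)).2 (by simp [or_comm])
    rw [List.nodup_append]
    refine ⟨Finset.sort_nodup _ _, by simp, ?_⟩
    intro a ha b hb
    rw [List.mem_singleton] at hb
    rw [hb]
    exact (hn a (by simpa using ha)).ne

theorem sort_pos {n : ℕ} {T : Finset ℕ} (hT : T ⊆ Icc 1 n) :
    ∀ x ∈ (insert (n + 1) T).sort, 0 < x := by
  intro x hx
  simp only [Finset.mem_sort, mem_insert] at hx
  rcases hx with rfl | hx
  · omega
  · exact (mem_Icc.1 (hT hx)).1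

theorem comp_pos {n : ℕ} {T : Finset ℕ} (hT : T ⊆ Icc 1 n) : ∀ b ∈ comp n T, 0 < b := by
  rw [comp_eq_diffs_sort hT]
  exact diffs_pos (Finset.sortedLT_sort _).pairwise (sort_pos hT)

theorem cuts_comp {n : ℕ} {T : Finset ℕ} (hT : T ⊆ Icc 1 n) :
    cuts 0 (comp n T) = insert (n + 1) T := by
  rw [comp_eq_diffs_sort hT, cuts_diffs (Finset.sortedLT_sort _).pairwise (sort_pos hT),
    Finset.sort_toFinset]

theorem comp_eq_of_cuts_eq {n : ℕ} {T : Finset ℕ} (hT : T ⊆ Icc 1 n) {β : List ℕ}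
    (hβ : ∀ b ∈ β, 0 < b) (h : cuts 0 β = insert (n + 1) T) : comp n T = β := by
  rw [comp_eq_diffs_sort hT, ← h, diffs_sort_cuts hβ]

theorem comp_ne_nil (n : ℕ) (T : Finset ℕ) : comp n T ≠ [] := by
  rw [comp]
  cases T.sort <;> simp [diffs]

theorem sum_comp {n : ℕ} {T : Finset ℕ} (hT : T ⊆ Icc 1 n) : (comp n T).sum = n + 1 := by
  have h1 : 0 + (comp n T).sum ∈ cuts 0 (comp n T) := add_sum_mem_cuts (comp_ne_nil n T)
  have h2 : n + 1 ∈ cuts 0 (comp n T) := by simp [cuts_comp hT]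
  have h3 := (lt_of_mem_cuts (comp_pos hT) h2).2
  rw [cuts_comp hT, mem_insert] at h1
  rcases h1 with h1 | h1
  · omega
  · have := (mem_Icc.1 (hT h1)).2
    omega

theorem comp_injOn {n : ℕ} {T T' : Finset ℕ} (hT : T ⊆ Icc 1 n) (hT' : T' ⊆ Icc 1 n)
    (h : comp n T = comp n T') : T = T' := by
  have h' := congrArg (cuts 0) h
  rw [cuts_comp hT, cuts_comp hT'] at h'
  have hn : n + 1 ∉ T := fun hx => by have := (mem_Icc.1 (hT hx)).2; omega
  have hn' : n + 1 ∉ T' := fun hx => by have := (mem_Icc.1 (hT' hx)).2; omega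
  rw [← erase_insert hn, h', erase_insert hn']

theorem exists_comp_eq {β : List ℕ} (hβ : ∀ b ∈ β, 0 < b) (hne : β ≠ []) {n : ℕ}
    (hs : β.sum = n + 1) : ∃ T ⊆ Icc 1 n, comp n T = β := by
  have hsub : (cuts 0 β).erase (n + 1) ⊆ Icc 1 n := by
    intro x hx
    rw [mem_erase] at hx
    have := lt_of_mem_cuts hβ hx.2
    rw [mem_Icc]
    omega
  refine ⟨_, hsub, comp_eq_of_cuts_eq hsub hβ ?_⟩
  rw [insert_erase]
  have := add_sum_mem_cuts (p := 0) hne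
  rwa [hs, zero_add] at this

/-- Two consecutive cuts bound exactly one part, of size `k - i`. This turns the gap `i < k` of a
Dehn–Sommerville relation into a part that can be split. -/
theorem exists_split {p i k : ℕ} {β : List ℕ} (hβ : ∀ b ∈ β, 0 < b) (hi : i = p ∨ i ∈ cuts p β)
    (hk : k ∈ cuts p β) (hik : i < k) (hgap : ∀ j ∈ cuts p β, ¬ (i < j ∧ j < k)) :
    ∃ α γ, β = α ++ [k - i] ++ γ ∧ p + α.sum = i := by
  induction β generalizing p with
  | nil => simp [cuts] at hk
  | cons b l ih =>
    simp only [List.mem_cons, forall_eq_or_imp] at hβ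
    have hrec : i ∈ cuts p (b :: l) → ∃ α γ, b :: l = α ++ [k - i] ++ γ ∧ p + α.sum = i := by
      intro hi
      have hk' : k ∈ cuts (p + b) l := by
        simp only [cuts, mem_insert] at hi hk
        rcases hk with rfl | hk
        · rcases hi with rfl | hi
          · omega
          · have := lt_of_mem_cuts hβ.2 hi
            omega
        · exact hk
      obtain ⟨α, γ, h, h'⟩ := ih hβ.2 (by simpa [cuts] using hi) hk'
        (fun j hj => hgap j (by simp [cuts, hj]))
      exact ⟨b :: α, γ, by simp [h], by simp [← h', add_assoc]⟩
    rcases hi with rfl | hi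
    · refine ⟨[], l, ?_, by simp⟩
      have h1 := hgap (i + b) (by simp [cuts])
      simp only [cuts, mem_insert] at hk
      have : k = i + b := by
        rcases hk with rfl | hk
        · rfl
        · have := lt_of_mem_cuts hβ.2 hk
          omega
      simp [this]
    · exact hrec hi

/-- Splitting a part `K` of the composition of `T` into `x + y` inserts the corresponding partial
sum into `T`; nothing changes if `x` or `y` is zero. -/
theorem filter_split_eq_comp {n i K x y : ℕ} {T : Finset ℕ} {α γ : List ℕ} (hT : T ⊆ Icc 1 n)
    (hα : α.sum = i) (h : comp n T = α ++ [K] ++ γ) (hxy : x + y = K) :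
    (α ++ [x, y] ++ γ).filter (· ≠ 0) = comp n ((insert (i + x) T) ∩ Icc 1 n) := by
  have hpos := comp_pos hT
  have hcuts := cuts_comp hT
  have hsum := sum_comp hT
  rw [h] at hpos hcuts hsum
  have hαp : ∀ b ∈ α, 0 < b := fun b hb => hpos b (by simp [hb])
  have hγp : ∀ b ∈ γ, 0 < b := fun b hb => hpos b (by simp [hb])
  have hKp : 0 < K := hpos K (by simp)
  have fα : α.filter (· ≠ 0) = α := List.filter_eq_self.2 fun b hb => by
    simpa using (hαp b hb).ne'
  have fγ : γ.filter (· ≠ 0) = γ := List.filter_eq_self.2 fun b hb => by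
    simpa using (hγp b hb).ne'
  simp only [List.sum_append, List.sum_cons, List.sum_nil, hα] at hsum
  -- If `x` or `y` is zero, the new cut is an old one or one of the ends `0`, `n + 1`; the
  -- intersection with `[n]` discards the ends.
  have hsame : (insert (i + x) T) ∩ Icc 1 n = T → x = 0 ∨ y = 0 →
      (α ++ [x, y] ++ γ).filter (· ≠ 0) = comp n ((insert (i + x) T) ∩ Icc 1 n) := by
    intro hT' h0
    rw [hT', h, List.filter_append, List.filter_append, fα, fγ]
    rcases h0 with rfl | rfl
    · have : K = y := by omega
      subst this
      simp [hKp.ne']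
    · have : K = x := by omega
      subst this
      simp [hKp.ne']
  rcases Nat.eq_zero_or_pos x with rfl | hx
  · refine hsame ?_ (Or.inl rfl)
    rcases eq_or_ne α [] with rfl | hne
    · simp only [List.sum_nil] at hα
      subst hα
      ext z
      simp only [mem_inter, mem_insert, mem_Icc]
      constructor
      · rintro ⟨h | h, _⟩
        · omega
        · exact h
      · exact fun hz => ⟨Or.inr hz, mem_Icc.1 (hT hz)⟩
    · have hi : i ∈ T := by
        have h1 : i ∈ insert (n + 1) T := by
          rw [← hcuts, cuts_append, cuts_append, mem_union, mem_union]
          refine Or.inl (Or.inl ?_)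
          have := add_sum_mem_cuts (p := 0) hne
          rwa [hα, zero_add] at this
        rw [mem_insert] at h1
        rcases h1 with h1 | h1
        · omega
        · exact h1
      rw [add_zero, insert_eq_self.2 hi, inter_eq_left.2 hT]
  rcases Nat.eq_zero_or_pos y with rfl | hy
  · refine hsame ?_ (Or.inr rfl)
    have h1 : i + x ∈ insert (n + 1) T := by
      rw [← hcuts, cuts_append, cuts_append, mem_union, mem_union]
      refine Or.inl (Or.inr ?_)
      simp only [cuts, hα]
      simp; omega
    rw [mem_insert] at h1
    rcases h1 with h1 | h1
    · rw [h1]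
      ext z
      simp only [mem_inter, mem_insert, mem_Icc]
      constructor
      · rintro ⟨h | h, _⟩
        · omega
        · exact h
      · exact fun hz => ⟨Or.inr hz, mem_Icc.1 (hT hz)⟩
    · rw [insert_eq_self.2 h1, inter_eq_left.2 hT]
  · have hmem : insert (i + x) T ⊆ Icc 1 n := by
      refine insert_subset ?_ hT
      rw [mem_Icc]
      omega
    rw [inter_eq_left.2 hmem, List.filter_append, List.filter_append, fα, fγ]
    have : [x, y].filter (· ≠ 0) = [x, y] := by simp [hx.ne', hy.ne']
    rw [this]
    symm
    refine comp_eq_of_cuts_eq hmem ?_ ?_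
    · simp only [List.mem_append, List.mem_cons, List.not_mem_nil, or_false]
      rintro b ((hb | rfl | rfl) | hb)
      exacts [hαp b hb, hx, hy, hγp b hb]
    · rw [Finset.insert_comm, ← hcuts]
      simp only [cuts_append, cuts, hα, zero_add, List.sum_append, List.sum_cons, List.sum_nil,
        add_zero, ← hxy, add_assoc]
      ext z
      simp only [mem_union, mem_insert, notMem_empty, or_false]
      tauto

/-! ### Exponent lists and quasisymmetry -/

theorem exponents_eq_map_sort {m : ℕ →₀ ℕ} {A : Finset ℕ} (hA : m.support ⊆ A) :
    exponents m = (A.sort.map m).filter (· ≠ 0) := by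
  rw [exponents, List.filter_map]
  congr 1
  refine List.Perm.eq_of_pairwise (le := (· ≤ ·)) (fun a b _ _ h h' => le_antisymm h h')
    (Finset.pairwise_sort _ _) ((Finset.pairwise_sort _ _).filter _) ?_
  refine (List.perm_ext_iff_of_nodup (Finset.sort_nodup _ _)
    ((Finset.sort_nodup _ _).filter _)).2 fun x => ?_
  simp only [Finset.mem_sort, List.mem_filter, Finsupp.mem_support_iff, Function.comp_apply,
    decide_eq_true_eq, ne_eq]
  exact ⟨fun h => ⟨hA (Finsupp.mem_support_iff.2 h), h⟩, fun h => h.2⟩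

theorem exponents_toFinsupp (L : List ℕ) : exponents L.toFinsupp = L.filter (· ≠ 0) := by
  rw [exponents_eq_map_sort (L.toFinsupp_support_subset), Finset.sort_range]
  congr 1
  refine List.ext_getElem (by simp) fun i h1 h2 => ?_
  simp [h2]

theorem exponents_pos (m : ℕ →₀ ℕ) : ∀ b ∈ exponents m, 0 < b := by
  intro b hb
  simp only [exponents, List.mem_map, Finset.mem_sort, Finsupp.mem_support_iff] at hb
  obtain ⟨a, ha, rfl⟩ := hb
  exact Nat.pos_of_ne_zero ha

theorem exponents_embDomain (g : ℕ ↪o ℕ) (m : ℕ →₀ ℕ) :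
    exponents (m.embDomain g.toEmbedding) = exponents m := by
  have : (m.embDomain g.toEmbedding).support.sort = m.support.sort.map g := by
    refine List.Perm.eq_of_pairwise (le := (· ≤ ·)) (fun a b _ _ h h' => le_antisymm h h')
      (Finset.pairwise_sort _ _) ?_ ?_
    · rw [List.pairwise_map]
      exact (Finset.pairwise_sort _ _).imp fun h => g.monotone h
    · refine (List.perm_ext_iff_of_nodup (Finset.sort_nodup _ _)
        ((List.nodup_map_iff g.injective).2 (Finset.sort_nodup _ _))).2 fun x => ?_
      simp
  rw [exponents, this, List.map_map, exponents]
  refine List.map_congr_left fun a _ => ?_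
  exact Finsupp.embDomain_apply_self g.toEmbedding m a

/-- Send `j` to the `j`-th element of the support, and continue increasingly past the support. -/
theorem exists_embDomain_exponents (m : ℕ →₀ ℕ) :
    ∃ g : ℕ ↪o ℕ, m = (exponents m).toFinsupp.embDomain g.toEmbedding := by
  set l := m.support.sort with hl
  -- A bound beyond the whole support, so that continuing with `N + j` keeps the map strictly
  -- increasing.
  set N := m.support.sup id + 1 with hN
  have hlN : ∀ x ∈ l, x < N := fun x hx =>
    Nat.lt_succ_of_le (le_sup (f := id) (by simpa [hl] using hx))
  have hmono : StrictMono fun j => if h : j < l.length then l[j] else N + j := by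
    intro a b hab
    by_cases hb : b < l.length
    · have ha : a < l.length := hab.trans hb
      simp only [ha, hb, dif_pos]
      exact List.pairwise_iff_getElem.1 (Finset.sortedLT_sort _).pairwise _ _ ha hb hab
    · by_cases ha : a < l.length
      · simp only [ha, hb, dif_pos, dif_neg, not_false_iff]
        have := hlN _ (List.getElem_mem ha)
        omega
      · simp only [ha, hb, dif_neg, not_false_iff]
        omega
  refine ⟨OrderEmbedding.ofStrictMono _ hmono, ?_⟩
  ext x
  by_cases hx : x ∈ m.support
  · obtain ⟨j, hj, hjx⟩ := List.getElem_of_mem (show x ∈ l by simpa [hl] using hx)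
    have hg : (OrderEmbedding.ofStrictMono _ hmono).toEmbedding j = x := by
      simp [hj, hjx]
    conv_rhs => rw [← hg]
    rw [Finsupp.embDomain_apply_self, List.toFinsupp_apply]
    have hj' : j < (exponents m).length := by simpa [exponents, hl] using hj
    rw [List.getD_eq_getElem _ _ hj']
    simp [exponents, ← hl, hjx]
  · rw [Finsupp.notMem_support_iff.1 hx]
    symm
    by_cases hr : x ∈ Set.range (OrderEmbedding.ofStrictMono _ hmono).toEmbedding
    · obtain ⟨j, rfl⟩ := hr
      rw [Finsupp.embDomain_apply_self, List.toFinsupp_apply]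
      refine List.getD_eq_default _ _ ?_
      by_contra hj
      have hj : j < l.length := by simpa [exponents, hl] using hj
      apply hx
      have h := List.getElem_mem hj
      have hg : (OrderEmbedding.ofStrictMono _ hmono).toEmbedding j = l[j] := by simp [hj]
      rw [hg]
      exact (Finset.mem_sort _).1 h
    · exact Finsupp.embDomain_of_notMem_range _ _ _ hr

/-- Power series whose coefficients are invariant under insertions of zeros into the sequence of
the exponents. -/
noncomputable def quasiSymm : Subalgebra ℚ (MvPowerSeries ℕ ℚ) :=
  ⨅ g : ℕ ↪o ℕ, AlgHom.equalizer (MvPowerSeries.killCompl g.toEmbedding) (AlgHom.id ℚ _)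

/-- Order embeddings of the variables preserve exponent lists, and every monomial is the image under
one of the packed monomial with the same list. The definition by equalizers makes closure under
products automatic. -/
theorem mem_quasiSymm {F : MvPowerSeries ℕ ℚ} :
    F ∈ quasiSymm ↔ ∀ m, MvPowerSeries.coeff m F =
      MvPowerSeries.coeff (exponents m).toFinsupp F := by
  have : F ∈ quasiSymm ↔ ∀ (g : ℕ ↪o ℕ) m,
      MvPowerSeries.coeff (m.embDomain g.toEmbedding) F = MvPowerSeries.coeff m F := by
    simp only [quasiSymm, Algebra.mem_iInf, AlgHom.mem_equalizer, AlgHom.id_apply,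
      MvPowerSeries.ext_iff, MvPowerSeries.coeff_killCompl]
  rw [this]
  constructor
  · intro h m
    obtain ⟨g, hg⟩ := exists_embDomain_exponents m
    conv_lhs => rw [hg]
    exact h g _
  · intro h g m
    rw [h, exponents_embDomain, ← h]

/-! ### The substitution `x (p + 1) = - x p` and the subalgebra it defines -/

/-- The map which identifies `p + 1` with `p`. -/
def mergeSucc (p j : ℕ) : ℕ := if j = p + 1 then p else j

instance (p : ℕ) : Filter.TendstoCofinite (mergeSucc p) := by
  rw [Filter.tendstoCofinite_iff_finite_preimage_singleton]
  intro b
  refine (Set.toFinite {b, p + 1}).subset fun x hx => ?_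
  simp only [Set.mem_preimage, mergeSucc, Set.mem_singleton_iff] at hx
  simp only [Set.mem_insert_iff, Set.mem_singleton_iff]
  split_ifs at hx <;> omega

/-- The scaling factors `u` for `x p`, `v` for `x (p + 1)`, and 1 for the other variables. -/
def pairScale (p : ℕ) (u v : ℚ) (j : ℕ) : ℚ := if j = p then u else if j = p + 1 then v else 1

/-- The substitution of `u * x p` for `x p` and of `v * x p` for `x (p + 1)`. -/
noncomputable def substPair (p : ℕ) (u v : ℚ) : MvPowerSeries ℕ ℚ →ₐ[ℚ] MvPowerSeries ℕ ℚ :=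
  (MvPowerSeries.rename (mergeSucc p)).comp (MvPowerSeries.rescaleAlgHom (pairScale p u v))

theorem prod_pairScale (p : ℕ) (u v : ℚ) (m : ℕ →₀ ℕ) :
    (m.prod fun s e => pairScale p u v s ^ e) = u ^ m p * v ^ m (p + 1) := by
  rw [Finsupp.prod_of_support_subset m (s := m.support ∪ {p, p + 1}) subset_union_left _ (by simp)]
  rw [← prod_subset (s₁ := {p, p + 1}) subset_union_right]
  · rw [prod_pair (by omega)]
    simp [pairScale]
  · intro x _ hx
    simp only [mem_insert, mem_singleton, not_or] at hx
    simp [pairScale, hx]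

theorem mapDomain_mergeSucc (p : ℕ) (m : ℕ →₀ ℕ) :
    m.mapDomain (mergeSucc p) = (m.update p (m p + m (p + 1))).update (p + 1) 0 := by
  have h : ∀ m : ℕ →₀ ℕ, m = (m.update p 0).update (p + 1) 0 + Finsupp.single p (m p) +
      Finsupp.single (p + 1) (m (p + 1)) := by
    intro m
    ext x
    by_cases h1 : x = p
    · subst h1; simp
    · by_cases h2 : x = p + 1
      · subst h2; simp
      · simp [h1, h2]
  conv_lhs => rw [h m, Finsupp.mapDomain_add, Finsupp.mapDomain_add, Finsupp.mapDomain_single,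
    Finsupp.mapDomain_single]
  -- With the exponents at `p` and `p + 1` removed, the merging map is the identity on the support.
  have h3 : ((m.update p 0).update (p + 1) 0).mapDomain (mergeSucc p) =
      (m.update p 0).update (p + 1) 0 := by
    refine (Finsupp.mapDomain_congr (g := id) fun x hx => ?_).trans Finsupp.mapDomain_id
    simp only [Finsupp.mem_support_iff, Finsupp.update_apply] at hx
    simp only [mergeSucc, id]
    grind
  rw [h3]
  ext x
  by_cases h1 : x = p
  · subst h1; simp [mergeSucc, Finsupp.update_apply]
  · by_cases h2 : x = p + 1
    · subst h2; simp [mergeSucc, Finsupp.update_apply]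
    · simp [mergeSucc, Finsupp.update_apply, h1, h2]

theorem coeff_substPair_of_ne {p : ℕ} {m : ℕ →₀ ℕ} (hm : m (p + 1) ≠ 0) (u v : ℚ)
    (F : MvPowerSeries ℕ ℚ) : MvPowerSeries.coeff m (substPair p u v F) = 0 := by
  rw [substPair, AlgHom.comp_apply]
  refine MvPowerSeries.coeff_rename_eq_zero _ _ ?_
  rintro ⟨m', rfl⟩
  rw [mapDomain_mergeSucc] at hm
  simp at hm

/-- The monomials that merge to `m` arise by distributing the exponent `m p` over the two variables.
-/
theorem coeff_substPair {p : ℕ} {m : ℕ →₀ ℕ} (hm : m (p + 1) = 0) (u v : ℚ)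
    (F : MvPowerSeries ℕ ℚ) : MvPowerSeries.coeff m (substPair p u v F) =
      ∑ z ∈ antidiagonal (m p), u ^ z.1 * v ^ z.2 *
        MvPowerSeries.coeff ((m.update p z.1).update (p + 1) z.2) F := by
  rw [substPair, AlgHom.comp_apply, MvPowerSeries.coeff_rename]
  symm
  refine sum_bij' (fun z _ => (m.update p z.1).update (p + 1) z.2)
    (fun m' _ => (m' p, m' (p + 1))) ?_ ?_ ?_ ?_ ?_
  · rintro ⟨x, y⟩ hz
    rw [HasAntidiagonal.mem_antidiagonal] at hz
    simp only [Set.Finite.mem_toFinset, Set.mem_preimage, Set.mem_singleton_iff]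
    rw [mapDomain_mergeSucc]
    ext j
    simp only [Finsupp.update_apply]
    grind
  · intro m' hm'
    simp only [Set.Finite.mem_toFinset, Set.mem_preimage, Set.mem_singleton_iff] at hm'
    rw [HasAntidiagonal.mem_antidiagonal, ← hm', mapDomain_mergeSucc]
    simp [Finsupp.update_apply]
  · rintro ⟨x, y⟩ hz
    simp [Finsupp.update_apply]
  · intro m' hm'
    simp only [Set.Finite.mem_toFinset, Set.mem_preimage, Set.mem_singleton_iff] at hm'
    rw [mapDomain_mergeSucc] at hm'
    ext j
    rw [← hm']
    simp only [Finsupp.update_apply]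
    grind
  · rintro ⟨x, y⟩ hz
    rw [MvPowerSeries.rescaleAlgHom_apply, MvPowerSeries.coeff_rescale, prod_pairScale]
    simp [Finsupp.update_apply]

theorem exists_eq_toFinsupp (m : ℕ →₀ ℕ) (p : ℕ) : ∃ α γ : List ℕ, α.length = p ∧
    m = (α ++ [m p, m (p + 1)] ++ γ).toFinsupp := by
  set N := m.support.sup id with hN
  refine ⟨(List.range p).map m, (List.range N).map fun j => m (p + 2 + j), by simp, ?_⟩
  ext j
  rw [List.toFinsupp_apply, List.getD_eq_getElem?_getD, List.append_assoc,
    List.getElem?_append]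
  simp only [List.length_map, List.length_range, List.getElem?_map, List.cons_append,
    List.nil_append]
  split_ifs with h
  · simp [List.getElem?_range h]
  · obtain ⟨e, rfl⟩ := Nat.exists_eq_add_of_le (not_lt.1 h)
    rw [Nat.add_sub_cancel_left]
    rcases e with _ | _ | e
    · simp
    · simp
    · simp only [List.getElem?_cons_succ, List.getElem?_map]
      by_cases he : e < N
      · simp [List.getElem?_range he, add_comm, add_left_comm]
      · have : p + (e + 1 + 1) ∉ m.support := fun hm => by
          have : p + (e + 1 + 1) ≤ N := le_sup (f := id) hm
          omega
        rw [List.getElem?_eq_none (by simpa using he)]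
        simpa using this

theorem update_toFinsupp (α γ : List ℕ) (a b x y : ℕ) :
    ((α ++ [a, b] ++ γ).toFinsupp.update α.length x).update (α.length + 1) y =
      (α ++ [x, y] ++ γ).toFinsupp := by
  ext j
  simp only [Finsupp.update_apply, List.toFinsupp_apply, List.getD_eq_getElem?_getD,
    List.append_assoc, List.getElem?_append, List.cons_append, List.nil_append]
  rcases lt_or_ge j α.length with h | h
  · simp [h, h.ne, (h.trans (Nat.lt_succ_self _)).ne]
  · obtain ⟨e, rfl⟩ := Nat.exists_eq_add_of_le h
    rcases e with _ | _ | e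
    · simp
    · simp
    · simp

/-- Power series which do not change when `x (p + 1) = - x p` is replaced by
`x p = x (p + 1) = 0`. -/
noncomputable def cancelling : Subalgebra ℚ (MvPowerSeries ℕ ℚ) :=
  ⨅ p : ℕ, AlgHom.equalizer (substPair p 1 (-1)) (substPair p 0 0)

/-- No monomial with `x (p + 1)` occurs after merging, and for exponent zero at `p` both
substitutions agree. What remains is a positive exponent `K` of `x p`, where substituting zeros
gives zero. -/
theorem mem_cancelling {F : MvPowerSeries ℕ ℚ} :
    F ∈ cancelling ↔ ∀ (α γ : List ℕ) (K : ℕ), 0 < K →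
      ∑ z ∈ antidiagonal K, (-1 : ℚ) ^ z.2 *
        MvPowerSeries.coeff (α ++ [z.1, z.2] ++ γ).toFinsupp F = 0 := by
  have hz : ∀ K, 0 < K → ∀ g : ℕ × ℕ → ℚ,
      ∑ z ∈ antidiagonal K, (0 : ℚ) ^ z.1 * 0 ^ z.2 * g z = 0 := by
    intro K hK g
    refine sum_eq_zero ?_
    rintro ⟨x, y⟩ hxy
    rw [HasAntidiagonal.mem_antidiagonal] at hxy
    simp only at hxy
    rcases Nat.eq_zero_or_pos x with rfl | hx
    · have : y ≠ 0 := by omega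
      simp [this]
    · simp [hx.ne']
  simp only [cancelling, Algebra.mem_iInf, AlgHom.mem_equalizer, MvPowerSeries.ext_iff]
  constructor
  · intro h α γ K hK
    have := h α.length (α ++ [K, 0] ++ γ).toFinsupp
    have e1 : (α ++ [K, 0] ++ γ).toFinsupp α.length = K := by
      simp [List.getD_eq_getElem?_getD]
    have e2 : (α ++ [K, 0] ++ γ).toFinsupp (α.length + 1) = 0 := by
      simp [List.getD_eq_getElem?_getD]
    rw [coeff_substPair e2, coeff_substPair e2, e1, hz K hK] at this
    rw [← this]
    refine sum_congr rfl fun z _ => ?_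
    rw [update_toFinsupp, one_pow, one_mul]
  · intro h p m
    by_cases hm : m (p + 1) = 0
    · rw [coeff_substPair hm, coeff_substPair hm]
      rcases Nat.eq_zero_or_pos (m p) with h0 | h0
      · simp [h0]
      · rw [hz _ h0]
        obtain ⟨α, γ, hα, hm'⟩ := exists_eq_toFinsupp m p
        rw [← h α γ (m p) h0]
        refine sum_congr rfl fun z _ => ?_
        rw [one_pow, one_mul]
        conv_lhs => rw [hm', ← hα, update_toFinsupp]
    · rw [coeff_substPair_of_ne hm, coeff_substPair_of_ne hm]

/-- Power series of bounded degree. -/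
noncomputable def boundedDegree : Subalgebra ℚ (MvPowerSeries ℕ ℚ) where
  carrier := {F | ∃ N, ∀ m : ℕ →₀ ℕ, N < m.degree → MvPowerSeries.coeff m F = 0}
  mul_mem' := by
    rintro F G ⟨N, hN⟩ ⟨N', hN'⟩
    refine ⟨N + N', fun m hm => ?_⟩
    rw [MvPowerSeries.coeff_mul]
    refine sum_eq_zero fun z hz => ?_
    rw [HasAntidiagonal.mem_antidiagonal] at hz
    rw [← hz, map_add] at hm
    by_cases h : N < z.1.degree
    · rw [hN _ h, zero_mul]
    · rw [hN' _ (by omega), mul_zero]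
  add_mem' := by
    rintro F G ⟨N, hN⟩ ⟨N', hN'⟩
    refine ⟨N + N', fun m hm => ?_⟩
    rw [map_add, hN _ (by omega), hN' _ (by omega), add_zero]
  algebraMap_mem' r := by
    refine ⟨0, fun m hm => ?_⟩
    rw [← MvPowerSeries.c_eq_algebraMap]
    refine MvPowerSeries.coeff_C_of_ne_zero ?_ r
    rintro rfl
    simp at hm

theorem mem_boundedDegree {F : MvPowerSeries ℕ ℚ} : F ∈ boundedDegree ↔
    ∃ N, ∀ m : ℕ →₀ ℕ, N < m.degree → MvPowerSeries.coeff m F = 0 := Iff.rfl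

theorem sum_exponents (m : ℕ →₀ ℕ) : (exponents m).sum = m.degree := by
  rw [Finsupp.degree_apply, exponents, ← Finset.sum_map_toList]
  exact List.Perm.sum_eq ((Finset.sort_perm_toList _ _).map _)

/-! ### The generalized Dehn–Sommerville relations -/

/-- The generalized Dehn–Sommerville relations for a function on the subsets of `[n]`: for
consecutive elements `i < k` of `T ∪ {0, n + 1}`, the alternating sum of the values at
`T ∪ {j}`, `i ≤ j ≤ k`, is zero. -/
def DehnSommerville {R : Type*} [Ring R] (n : ℕ) (f : Finset ℕ → R) : Prop :=
  ∀ T ⊆ Icc 1 n, ∀ i k, i < k → k ≤ n + 1 → (i = 0 ∨ i ∈ T) → (k = n + 1 ∨ k ∈ T) →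
    (∀ j ∈ T, ¬ (i < j ∧ j < k)) → ∑ j ∈ Icc i k, (-1) ^ j * f (insert j T ∩ Icc 1 n) = 0

theorem sum_antidiagonal_neg_one_pow {R : Type*} [Ring R] (i K : ℕ) (g : ℕ → R) :
    ∑ z ∈ HasAntidiagonal.antidiagonal K, (-1 : R) ^ z.2 * g (i + z.1) =
      (-1) ^ (i + K) * ∑ j ∈ Icc i (i + K), (-1) ^ j * g j := by
  rw [Finset.Nat.sum_antidiagonal_eq_sum_range_succ (fun x y => (-1 : R) ^ y * g (i + x)), mul_sum,
    ← Ico_add_one_right_eq_Icc, Finset.sum_Ico_eq_sum_range]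
  have : i + K + 1 - i = K.succ := by omega
  rw [this]
  refine sum_congr rfl fun x hx => ?_
  rw [mem_range] at hx
  obtain ⟨y, rfl⟩ := Nat.exists_eq_add_of_le (Nat.lt_succ_iff.1 hx)
  rw [← mul_assoc, ← pow_add, Nat.add_sub_cancel_left]
  congr 1
  have : i + (x + y) + (i + x) = 2 * (i + x) + y := by ring
  rw [this, pow_add, pow_mul]
  simp

theorem flagF_eq_coeff {F : MvPowerSeries ℕ ℚ} (hF : F ∈ quasiSymm) {m : ℕ →₀ ℕ} {n : ℕ}
    {T : Finset ℕ} (h : exponents m = comp n T) : MvPowerSeries.coeff m F = flagF F n T := by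
  rw [mem_quasiSymm.1 hF m, flagF, h]

/-- The exponent pairs `(z.1, z.2)` with sum `K` split one part `K = k - i` of a composition, which
amounts to adding `j = i + z.1` to `T`; the signs match up to a common factor. -/
theorem mem_cancelling_iff {F : MvPowerSeries ℕ ℚ} (hF : F ∈ quasiSymm) :
    F ∈ cancelling ↔ ∀ n, DehnSommerville n (flagF F n) := by
  have key : ∀ {n i K : ℕ} {T : Finset ℕ} {α γ : List ℕ}, T ⊆ Icc 1 n → α.sum = i →
      comp n T = α ++ [K] ++ γ →
      ∑ z ∈ HasAntidiagonal.antidiagonal K, (-1 : ℚ) ^ z.2 *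
        MvPowerSeries.coeff (α ++ [z.1, z.2] ++ γ).toFinsupp F =
      (-1) ^ (i + K) * ∑ j ∈ Icc i (i + K), (-1) ^ j * flagF F n (insert j T ∩ Icc 1 n) := by
    intro n i K T α γ hT hα h
    rw [← sum_antidiagonal_neg_one_pow i K fun j => flagF F n (insert j T ∩ Icc 1 n)]
    refine sum_congr rfl fun z hz => ?_
    rw [flagF_eq_coeff hF]
    rw [exponents_toFinsupp]
    exact filter_split_eq_comp hT hα h (HasAntidiagonal.mem_antidiagonal.1 hz)
  rw [mem_cancelling]
  constructor
  · intro h n T hT i k hik hk hi hk' hgap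
    have hc := cuts_comp hT
    obtain ⟨α, γ, hs, hα⟩ := exists_split (p := 0) (i := i) (k := k) (comp_pos hT)
      (by rw [hc, mem_insert]; tauto) (by rw [hc, mem_insert]; tauto) hik (by
        intro j hj
        rw [hc, mem_insert] at hj
        rcases hj with rfl | hj
        · omega
        · exact hgap j hj)
    rw [zero_add] at hα
    have h1 := h α γ (k - i) (by omega)
    rw [key hT hα hs, Nat.add_sub_cancel' hik.le] at h1
    exact (mul_eq_zero.1 h1).resolve_left (by simp)
  · intro h α γ K hK
    have hpos : ∀ b ∈ α.filter (· ≠ 0) ++ [K] ++ γ.filter (· ≠ 0), 0 < b := by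
      intro b hb
      simp only [List.mem_append, List.mem_filter, List.mem_singleton, ne_eq,
        decide_eq_true_eq] at hb
      omega
    -- Zero exponents are invisible to a quasisymmetric series, so they may be dropped to obtain a
    -- genuine composition.
    set α' := α.filter (· ≠ 0) with hα'
    set γ' := γ.filter (· ≠ 0) with hγ'
    obtain ⟨n, hn⟩ : ∃ n, (α' ++ [K] ++ γ').sum = n + 1 := by
      refine Nat.exists_eq_succ_of_ne_zero ?_
      simp only [List.sum_append, List.sum_singleton]
      omega
    obtain ⟨T, hT, hTc⟩ := exists_comp_eq hpos (by simp) hn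
    have h1 : ∑ z ∈ HasAntidiagonal.antidiagonal K, (-1 : ℚ) ^ z.2 *
        MvPowerSeries.coeff (α ++ [z.1, z.2] ++ γ).toFinsupp F =
        ∑ z ∈ HasAntidiagonal.antidiagonal K, (-1 : ℚ) ^ z.2 *
        MvPowerSeries.coeff (α' ++ [z.1, z.2] ++ γ').toFinsupp F := by
      refine sum_congr rfl fun z _ => ?_
      rw [mem_quasiSymm.1 hF, mem_quasiSymm.1 hF (α' ++ [z.1, z.2] ++ γ').toFinsupp,
        exponents_toFinsupp, exponents_toFinsupp]
      simp only [hα', hγ', List.filter_append, List.filter_filter, Bool.and_self]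
    have hcuts := cuts_comp hT
    have hsα : cuts 0 (comp n T) = cuts 0 α' ∪ ({α'.sum + K} ∪ cuts (α'.sum + K) γ') := by
      rw [hTc, List.append_assoc, cuts_append, cuts_append]
      simp [cuts]
    have hαp : ∀ b ∈ α', 0 < b := fun b hb => hpos b (by simp [hb])
    have hγp : ∀ b ∈ γ', 0 < b := fun b hb => hpos b (by simp [hb])
    simp only [List.sum_append, List.sum_singleton] at hn
    rw [h1, key hT rfl hTc, h n T hT _ _ (by omega) (by omega), mul_zero]
    · rcases eq_or_ne α' [] with h0 | h0
      · left; simp [h0]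
      · right
        have h2 := add_sum_mem_cuts (p := 0) h0
        have h3 : α'.sum ∈ insert (n + 1) T := by
          rw [← hcuts, hsα, mem_union]
          left; simpa using h2
        rw [mem_insert] at h3
        rcases h3 with h3 | h3
        · omega
        · exact h3
    · rw [← mem_insert, ← hcuts, hsα]
      simp
    · rintro j hj ⟨h2, h3⟩
      have h4 : j ∈ cuts 0 (comp n T) := by rw [hcuts]; exact mem_insert_of_mem hj
      rw [hsα, mem_union, mem_union, mem_singleton] at h4
      rcases h4 with h4 | h4 | h4
      · have := lt_of_mem_cuts hαp h4
        omega
      · omega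
      · have := lt_of_mem_cuts hγp h4
        omega

/-! ### The relations for the generators of the peak algebra -/

/-- `2 ^ |T|` if `X ⊆ T ∪ (T + 1)`, and zero otherwise. -/
def coverCount (R : Type*) [Ring R] (X T : Finset ℕ) : R :=
  if X ⊆ T ∪ T.image (· + 1) then 2 ^ #T else 0

/-- Adding `(-1) ^ j + (-1) ^ (j + 1) = 0` over `i ≤ j < k` counts the inner indices twice and the
ends once. -/
theorem two_mul_sum_Ioo_neg_one_pow {R : Type*} [CommRing R] {i k : ℕ} (h : i < k) :
    2 * ∑ j ∈ Ioo i k, (-1 : R) ^ j + (-1) ^ i + (-1) ^ k = 0 := by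
  obtain ⟨d, rfl⟩ := Nat.exists_eq_add_of_lt h
  clear h
  induction d with
  | zero =>
    have : Ioo i (i + 0 + 1) = ∅ := by ext; simp
    rw [this]; simp [pow_succ]
  | succ d ih =>
    have : Ioo i (i + (d + 1) + 1) = insert (i + d + 1) (Ioo i (i + d + 1)) := by
      ext; simp; omega
    rw [this, sum_insert (by simp)]
    have e : (-1 : R) ^ (i + (d + 1) + 1) = - (-1) ^ (i + d + 1) := by
      rw [show i + (d + 1) + 1 = i + d + 1 + 1 by ring, pow_succ]; ring
    rw [e]
    linear_combination ih

theorem LeftSparse.dehnSommerville_coverCount {R : Type*} [CommRing R] {n : ℕ} {X : Finset ℕ}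
    (hX : LeftSparse n X) : DehnSommerville n (coverCount R X) := by
  obtain ⟨hXn, hX1, hXs⟩ := hX
  intro T hT i k hik hk hi hk' hgap
  have hIT : insert i T ∩ Icc 1 n = T := by
    rcases hi with rfl | hi
    · ext z
      have := @hT z
      simp only [mem_inter, mem_insert, mem_Icc] at *
      constructor
      · rintro ⟨h | h, _⟩
        · omega
        · exact h
      · tauto
    · rw [insert_eq_self.2 hi, inter_eq_left.2 hT]
  have hKT : insert k T ∩ Icc 1 n = T := by
    rcases hk' with rfl | hk'
    · ext z
      have := @hT z
      simp only [mem_inter, mem_insert, mem_Icc] at *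
      constructor
      · rintro ⟨h | h, _⟩
        · omega
        · exact h
      · tauto
    · rw [insert_eq_self.2 hk', inter_eq_left.2 hT]
  -- The part of `X` not yet covered by `T`. A new element `j` covers `j` and `j + 1`, so only `|U|
  -- ≤ 1` can contribute, since `X` has no consecutive elements.
  set U := X \ (T ∪ T.image (· + 1)) with hU
  have hUX : ∀ u ∈ U, u ∈ X ∧ u ∉ T ∧ ∀ t ∈ T, t + 1 ≠ u := by
    intro u hu
    simp only [hU, mem_sdiff, mem_union, mem_image, not_or, not_exists, not_and] at hu
    exact ⟨hu.1, hu.2.1, hu.2.2⟩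
  have hIoo : ∀ j ∈ Ioo i k, coverCount R X (insert j T ∩ Icc 1 n) =
      2 * 2 ^ #T * if U ⊆ {j, j + 1} then 1 else 0 := by
    intro j hj
    rw [mem_Ioo] at hj
    have hjT : j ∉ T := fun h => hgap j h hj
    have : insert j T ⊆ Icc 1 n := insert_subset (by rw [mem_Icc]; omega) hT
    rw [inter_eq_left.2 this, coverCount, card_insert_of_notMem hjT]
    have hiff : X ⊆ insert j T ∪ (insert j T).image (· + 1) ↔ U ⊆ {j, j + 1} := by
      rw [hU, image_insert]
      simp only [subset_iff, mem_sdiff, mem_union, mem_insert, mem_singleton]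
      exact forall_congr' fun x => by tauto
    simp only [hiff]
    split_ifs <;> ring
  have hT0 : coverCount R X T = 2 ^ #T * if U = ∅ then 1 else 0 := by
    rw [coverCount]
    have : X ⊆ T ∪ T.image (· + 1) ↔ U = ∅ := by rw [hU, sdiff_eq_empty_iff_subset]
    simp only [this]
    split_ifs <;> ring
  have hIcc : Icc i k = insert i (insert k (Ioo i k)) := by ext; simp; omega
  rw [hIcc, sum_insert (by simp; omega), sum_insert (by simp), hIT, hKT,
    sum_congr rfl fun j hj => by rw [hIoo j hj], hT0]
  have hsum : 2 * ∑ j ∈ Ioo i k, (-1 : R) ^ j * (if U ⊆ {j, j + 1} then 1 else 0) +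
      ((-1) ^ i + (-1) ^ k) * (if U = ∅ then 1 else 0) = 0 := by
    rcases U.eq_empty_or_nonempty with h0 | ⟨u, hu⟩
    · have := two_mul_sum_Ioo_neg_one_pow (R := R) hik
      simp only [h0, empty_subset, if_true, mul_one]
      linear_combination this
    · have hne : U ≠ ∅ := ne_empty_of_mem hu
      rw [if_neg hne, mul_zero, add_zero]
      obtain ⟨huX, huT, huT1⟩ := hUX u hu
      have hun := mem_Icc.1 (hXn huX)
      have hu1 : u ≠ 1 := fun h => hX1 (h ▸ huX)
      -- For `U = {u}` the contributing `j` are `u - 1` and `u`, with opposite signs. Since `u ≠ i +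
      -- 1` and `u ≠ k`, either both or neither lie strictly between `i` and `k`.
      by_cases hs : U = {u}
      · simp only [hs, singleton_subset_iff, mem_insert, mem_singleton]
        have hui : u ≠ i + 1 := by
          rcases hi with rfl | hi
          · exact hu1
          · exact (huT1 i hi).symm
        have huk : u ≠ k := by
          rcases hk' with rfl | hk'
          · omega
          · exact fun h => huT (h ▸ hk')
        by_cases hr : i + 1 < u ∧ u < k
        · have hsub : ({u - 1, u} : Finset ℕ) ⊆ Ioo i k := by
            intro x; simp only [mem_insert, mem_singleton, mem_Ioo]; omega
          rw [← sum_subset hsub, sum_pair (by omega)]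
          · obtain ⟨v, rfl⟩ : ∃ v, u = v + 1 := ⟨u - 1, by omega⟩
            simp [pow_succ]
          · intro x _ hx
            simp only [mem_insert, mem_singleton, not_or] at hx
            rw [if_neg (by omega), mul_zero]
        · rw [sum_eq_zero, mul_zero]
          intro x hx
          rw [mem_Ioo] at hx
          rw [if_neg (by omega), mul_zero]
      · obtain ⟨v, hv, hvu⟩ : ∃ v ∈ U, v ≠ u := by
          by_contra! h
          exact hs (eq_singleton_iff_unique_mem.2 ⟨hu, h⟩)
        rw [sum_eq_zero, mul_zero]
        intro x hx
        rw [if_neg, mul_zero]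
        intro hsub
        have h1 := hsub hu
        have h2 := hsub hv
        simp only [mem_insert, mem_singleton] at h1 h2
        have h3 := hXs u huX
        have h4 := hXs v (hUX v hv).1
        rcases h1 with h1 | h1 <;> rcases h2 with h2 | h2
        · omega
        · apply h4
          rw [show v - 1 = u by omega]
          exact huX
        · apply h3
          rw [show u - 1 = v by omega]
          exact (hUX v hv).1
        · omega
  simp only [mul_left_comm _ (2 * 2 ^ #T : R), ← mul_sum]
  linear_combination (2 ^ #T : R) * hsum

/-! ### Coefficients of `M_S` and `Θ_S`; constraints on the peak algebra -/

theorem coeff_M (n : ℕ) (T : Finset ℕ) (m : ℕ →₀ ℕ) :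
    MvPowerSeries.coeff m (M n T) = if exponents m = comp n T then 1 else 0 := rfl

theorem flagF_M {n : ℕ} {T T' : Finset ℕ} (hT : T ⊆ Icc 1 n) (hT' : T' ⊆ Icc 1 n) :
    flagF (M n T') n T = if T' = T then 1 else 0 := by
  rw [flagF, coeff_M, exponents_toFinsupp, List.filter_eq_self.2]
  · have : comp n T = comp n T' ↔ T' = T :=
      ⟨fun h => (comp_injOn hT hT' h).symm, fun h => by rw [h]⟩
    simp only [this]
  · intro b hb
    simpa using (comp_pos hT b hb).ne'

theorem coeff_M_of_degree_ne {n : ℕ} {T : Finset ℕ} (hT : T ⊆ Icc 1 n) {m : ℕ →₀ ℕ}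
    (hm : m.degree ≠ n + 1) : MvPowerSeries.coeff m (M n T) = 0 := by
  rw [coeff_M, if_neg]
  intro h
  apply hm
  rw [← sum_exponents, h, sum_comp hT]

theorem M_mem_quasiSymm (n : ℕ) (T : Finset ℕ) : M n T ∈ quasiSymm := by
  rw [mem_quasiSymm]
  intro m
  rw [coeff_M, coeff_M, exponents_toFinsupp, List.filter_eq_self.2]
  intro b hb
  simpa using (exponents_pos m b hb).ne'

theorem thetaSet_mem_quasiSymm (n : ℕ) (S : Finset ℕ) : thetaSet n S ∈ quasiSymm :=
  sum_mem fun T _ => Subalgebra.smul_mem _ (M_mem_quasiSymm n T) _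

theorem coeff_thetaSet_of_degree_ne {n : ℕ} {S : Finset ℕ} {m : ℕ →₀ ℕ}
    (hm : m.degree ≠ n + 1) : MvPowerSeries.coeff m (thetaSet n S) = 0 := by
  rw [thetaSet, map_sum]
  refine sum_eq_zero fun T hT => ?_
  rw [mem_filter, mem_powerset] at hT
  rw [MvPowerSeries.coeff_smul, coeff_M_of_degree_ne hT.1 hm, mul_zero]

theorem degree_toFinsupp_comp {n : ℕ} {T : Finset ℕ} (hT : T ⊆ Icc 1 n) :
    (comp n T).toFinsupp.degree = n + 1 := by
  rw [← sum_exponents, exponents_toFinsupp, List.filter_eq_self.2, sum_comp hT]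
  intro b hb
  simpa using (comp_pos hT b hb).ne'

theorem flagF_thetaSet_of_ne {n n' : ℕ} {S T : Finset ℕ} (hT : T ⊆ Icc 1 n) (h : n' ≠ n) :
    flagF (thetaSet n' S) n T = 0 := by
  rw [flagF, coeff_thetaSet_of_degree_ne]
  rw [degree_toFinsupp_comp hT]
  omega

theorem flagF_thetaSet {n : ℕ} {S T : Finset ℕ} (hT : T ⊆ Icc 1 n) :
    flagF (thetaSet n S) n T = 2 * coverCount ℚ S T := by
  have h1 : flagF (thetaSet n S) n T =
      ∑ T' ∈ (Icc 1 n).powerset with S ⊆ T' ∪ T'.image (· + 1),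
        (2 : ℚ) ^ (#T' + 1) * if T' = T then 1 else 0 := by
    rw [flagF, thetaSet, map_sum]
    refine sum_congr rfl fun T' hT' => ?_
    rw [mem_filter, mem_powerset] at hT'
    rw [MvPowerSeries.coeff_smul, ← flagF_M hT hT'.1, flagF]
  rw [h1]
  simp only [mul_ite, mul_one, mul_zero]
  rw [sum_ite_eq', coverCount]
  simp only [mem_filter, mem_powerset, hT, true_and]
  split_ifs
  · ring
  · ring

theorem DehnSommerville.congr {R : Type*} [Ring R] {n : ℕ} {f g : Finset ℕ → R}
    (hf : DehnSommerville n f) (h : ∀ T ⊆ Icc 1 n, g T = f T) : DehnSommerville n g := by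
  intro T hT i k hik hk hi hk' hgap
  rw [← hf T hT i k hik hk hi hk' hgap]
  exact sum_congr rfl fun j _ => by rw [h _ inter_subset_right]

theorem DehnSommerville.const_mul {R : Type*} [CommRing R] {n : ℕ} {f : Finset ℕ → R}
    (hf : DehnSommerville n f) (c : R) : DehnSommerville n fun T => c * f T := by
  intro T hT i k hik hk hi hk' hgap
  simp only [mul_left_comm _ c, ← mul_sum]
  rw [hf T hT i k hik hk hi hk' hgap, mul_zero]

theorem LeftSparse.thetaSet_mem_cancelling {n : ℕ} {S : Finset ℕ} (hS : LeftSparse n S) :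
    thetaSet n S ∈ cancelling := by
  rw [mem_cancelling_iff (thetaSet_mem_quasiSymm n S)]
  intro n'
  rcases eq_or_ne n n' with rfl | h
  · exact (hS.dehnSommerville_coverCount.const_mul (2 : ℚ)).congr fun T hT => flagF_thetaSet hT
  · intro T hT i k _ _ _ _ _
    refine sum_eq_zero fun j _ => ?_
    rw [flagF_thetaSet_of_ne inter_subset_right h, mul_zero]

/-- All three conditions define subalgebras, so only the generators have to be checked. The degree
bound is what later makes the expansion finite. -/
theorem peakAlgebra_le : peakAlgebra ≤ quasiSymm ⊓ cancelling ⊓ boundedDegree := by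
  refine Algebra.adjoin_le ?_
  rintro F ⟨n, S, hS, rfl⟩
  refine ⟨⟨thetaSet_mem_quasiSymm n S, hS.thetaSet_mem_cancelling⟩, n + 1, fun m hm => ?_⟩
  exact coeff_thetaSet_of_degree_ne (by omega)

/-! ### Möbius inversion on finite sets -/

section Moebius

variable {R : Type*} [CommRing R]

theorem sum_moebius (f : Finset ℕ → R) (S : Finset ℕ) : ∑ T ∈ S.powerset, moebius f T = f S := by
  have inner : ∀ U ∈ S.powerset, ∑ T ∈ Icc U S, (-1 : R) ^ (#T - #U) =
      if U = S then 1 else 0 := by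
    intro U hU
    rw [mem_powerset] at hU
    rw [Icc_eq_image_powerset hU, sum_image]
    · have h : ∀ V ∈ (S \ U).powerset, (-1 : R) ^ (#(U ∪ V) - #U) = (-1) ^ #V := by
        intro V hV
        rw [mem_powerset] at hV
        rw [card_union_of_disjoint (disjoint_sdiff.mono_right hV), Nat.add_sub_cancel_left]
      rw [sum_congr rfl h]
      have := congrArg (Int.cast : ℤ → R) (sum_powerset_neg_one_pow_card (x := S \ U))
      push_cast at this
      rw [this]
      have h2 : S \ U = ∅ ↔ U = S :=
        ⟨fun h => subset_antisymm hU (sdiff_eq_empty_iff_subset.1 h),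
          fun h => by rw [h, Finset.sdiff_self]⟩
      simp only [h2]
    · intro V hV W hW h
      simp only [coe_powerset, Set.mem_preimage, Set.mem_powerset_iff, coe_subset] at hV hW
      have hV' := disjoint_sdiff.mono_right hV
      have hW' := disjoint_sdiff.mono_right hW
      have := congrArg (· \ U) h
      simpa [union_sdiff_cancel_left hV', union_sdiff_cancel_left hW'] using this
  simp only [moebius]
  rw [sum_comm' (t' := S.powerset) (s' := fun U => Icc U S)]
  · rw [sum_congr rfl fun U hU => by rw [← sum_mul, inner U hU]]
    simp
  · intro T U
    simp only [mem_powerset, mem_Icc]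
    exact ⟨fun h => ⟨⟨h.2, h.1⟩, h.2.trans h.1⟩, fun h => ⟨h.1.2, h.1.1⟩⟩

/-- Only subsets of `S` enter the hypothesis, because the identities to be inverted hold only inside
`[n]` or only for right sparse sets; both classes are closed under taking subsets. -/
theorem moebius_eq_of_sum {f g : Finset ℕ → R} {S : Finset ℕ}
    (h : ∀ S' ⊆ S, ∑ T ∈ S'.powerset, g T = f S') : moebius f S = g S := by
  induction S using Finset.strongInduction with
  | H S ih =>
    have h1 := sum_moebius f S
    rw [← h S subset_rfl, ← insert_erase (mem_powerset_self S),
      sum_insert (notMem_erase _ _), sum_insert (notMem_erase _ _)] at h1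
    have h2 : ∑ T ∈ S.powerset.erase S, moebius f T = ∑ T ∈ S.powerset.erase S, g T := by
      refine sum_congr rfl fun T hT => ?_
      rw [mem_erase, mem_powerset] at hT
      exact ih T (hT.2.ssubset_of_ne hT.1) fun S' hS' => h S' (hS'.trans hT.2)
    rw [h2] at h1
    exact add_right_cancel h1

end Moebius

/-! ### The `f`-, `h`- and `k`-vectors of a word -/

section Indicators

variable (R : Type*) [CommRing R]

/-- The indicator of the sets `S` which contain exactly one of `x - 1`, `x` for every `x ∈ X`. -/
def xorInd (X S : Finset ℕ) : R := if ∀ x ∈ X, (x - 1 ∈ S ↔ x ∉ S) then 1 else 0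

open scoped Classical in
/-- The indicator of the sets `S` with `|S| = |X|` such that `X` blocks the `{i, i + 1}`,
`i ∈ S`. -/
noncomputable def blockInd (X S : Finset ℕ) : R :=
  if #X = #S ∧ Blocks (intervals S) X then 1 else 0

theorem blocks_intervals {X S : Finset ℕ} :
    Blocks (intervals S) X ↔ ∀ i ∈ S, i ∈ X ∨ i + 1 ∈ X := by
  simp only [Blocks, intervals, forall_mem_image]
  refine forall₂_congr fun i _ => ?_
  simp only [Finset.Nonempty, mem_inter, mem_insert, mem_singleton]
  constructor
  · rintro ⟨x, hx, rfl | rfl⟩ <;> simp [hx]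
  · rintro (h | h)
    exacts [⟨i, h, Or.inl rfl⟩, ⟨i + 1, h, Or.inr rfl⟩]

/-- The pairs `{x - 1, x}`, `x ∈ X`, are disjoint. If `T` contains `e` elements of a pair, there are
`e` ways to choose one, and `2 * e = 2 ^ e` for `e = 1, 2`, while `e = 0` means that `x` is not
covered. Elements of `T` outside all pairs are free and contribute a factor 2 each. -/
theorem two_pow_mul_sum_xorInd {X : Finset ℕ} (h0 : 0 ∉ X) (hX : ∀ x ∈ X, x - 1 ∉ X)
    (T : Finset ℕ) : 2 ^ #X * ∑ S ∈ T.powerset, xorInd R X S = coverCount R X T := by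
  induction X using Finset.induction_on generalizing T with
  | empty => simp [xorInd, coverCount]
  | insert x X hx ih =>
    have hx0 : x ≠ 0 := fun h => h0 (by simp [h])
    have hy : ∀ y ∈ X, y ≠ 0 ∧ y ≠ x ∧ y - 1 ≠ x ∧ y ≠ x - 1 ∧ y - 1 ≠ x - 1 ∧ y ≠ x + 1 := by
      intro y hy
      have h1 : y ≠ 0 := fun h => h0 (by simp [← h, hy])
      have h2 : y ≠ x := fun h => hx (h ▸ hy)
      have h3 : y - 1 ≠ x := fun h => hX y (by simp [hy]) (by simp [h])
      have h4 : x - 1 ≠ y := fun h => hX x (by simp) (by simp [h, hy])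
      omega
    have ih' := ih (fun h => h0 (by simp [h]))
      (fun y hy h => hX y (by simp [hy]) (by simp [h]))
    -- The pair of `x` is split off from `T`; the other elements of `X` do not see it.
    set T₁ := (T.erase (x - 1)).erase x with hT₁
    have hx1 : x ∉ T₁ := by simp [hT₁]
    have hx2 : x - 1 ∉ T₁ := by simp [hT₁]
    have hxx : x ≠ x - 1 := by omega
    have hi := ih' T₁
    have eX : ∀ S, xorInd R (insert x X) S =
        if (x - 1 ∈ S ↔ x ∉ S) then xorInd R X S else 0 := by
      intro S
      simp only [xorInd, forall_mem_insert]
      split_ifs <;> tauto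
    have e1 : ∀ S, xorInd R X (insert x S) = xorInd R X S := by
      intro S
      simp only [xorInd]
      congr 1
      simp only [eq_iff_iff]
      refine forall₂_congr fun y hyX => ?_
      have := hy y hyX
      simp [this]
    have e2 : ∀ S, xorInd R X (insert (x - 1) S) = xorInd R X S := by
      intro S
      simp only [xorInd]
      congr 1
      simp only [eq_iff_iff]
      refine forall₂_congr fun y hyX => ?_
      have := hy y hyX
      simp [this]
    have cov : ∀ (A : Finset ℕ), (A ⊆ {x - 1, x}) → coverCount R (insert x X) (A ∪ T₁) =
        if A = ∅ then 0 else 2 ^ #A * coverCount R X T₁ := by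
      intro A hA
      have hdisj : Disjoint A T₁ := by
        rw [disjoint_left]
        intro a ha
        have := hA ha
        simp only [mem_insert, mem_singleton] at this
        rcases this with rfl | rfl
        exacts [hx2, hx1]
      have hcov : X ⊆ (A ∪ T₁) ∪ (A ∪ T₁).image (· + 1) ↔ X ⊆ T₁ ∪ T₁.image (· + 1) := by
        constructor
        · intro h1 y hyX
          have h4 := h1 hyX
          have h5 := hy y hyX
          simp only [mem_union, mem_image] at h4 ⊢
          rcases h4 with (h4 | h4) | ⟨a, h4 | h4, rfl⟩
          · have := hA h4
            simp only [mem_insert, mem_singleton] at this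
            omega
          · exact Or.inl h4
          · have := hA h4
            simp only [mem_insert, mem_singleton] at this
            omega
          · exact Or.inr ⟨a, h4, rfl⟩
        · exact fun h => h.trans (union_subset_union subset_union_right
            (image_subset_image subset_union_right))
      simp only [coverCount, card_union_of_disjoint hdisj]
      split_ifs with h1 hA0 h3 hA0 h3
      · exfalso
        have := h1 (mem_insert_self x X)
        simp only [hA0, empty_union, mem_union, mem_image] at this
        rcases this with h | ⟨a, ha, rfl⟩
        · exact hx1 h
        · exact hx2 (by simpa using ha)
      · rw [pow_add]
      · exact absurd (hcov.1 fun y hyX => h1 (mem_insert_of_mem hyX)) h3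
      · rfl
      · exfalso
        apply h1
        rw [insert_subset_iff]
        refine ⟨?_, hcov.2 h3⟩
        simp only [mem_union, mem_image]
        obtain ⟨a, ha⟩ := nonempty_iff_ne_empty.2 hA0
        have := hA ha
        simp only [mem_insert, mem_singleton] at this
        rcases this with rfl | rfl
        · exact Or.inr ⟨x - 1, Or.inl ha, by omega⟩
        · exact Or.inl (Or.inl ha)
      · rw [mul_zero]
    -- Of the four possible traces of a set on `{x - 1, x}`, only the two singletons contribute.
    have s0 : ∑ S ∈ T₁.powerset, xorInd R (insert x X) S = 0 := by
      refine sum_eq_zero fun S hS => ?_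
      rw [mem_powerset] at hS
      rw [eX, if_neg]
      have h1 : x ∉ S := fun h => hx1 (hS h)
      have h2 : x - 1 ∉ S := fun h => hx2 (hS h)
      tauto
    have s1 : ∑ S ∈ T₁.powerset, xorInd R (insert x X) (insert x S) =
        ∑ S ∈ T₁.powerset, xorInd R X S := by
      refine sum_congr rfl fun S hS => ?_
      rw [mem_powerset] at hS
      rw [eX, if_pos, e1]
      have h2 : x - 1 ∉ S := fun h => hx2 (hS h)
      simp [h2, hxx.symm]
    have s2 : ∑ S ∈ T₁.powerset, xorInd R (insert x X) (insert (x - 1) S) =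
        ∑ S ∈ T₁.powerset, xorInd R X S := by
      refine sum_congr rfl fun S hS => ?_
      rw [mem_powerset] at hS
      rw [eX, if_pos, e2]
      have h2 : x ∉ S := fun h => hx1 (hS h)
      simp [h2, hxx]
    have s3 : ∑ S ∈ T₁.powerset, xorInd R (insert x X) (insert x (insert (x - 1) S)) = 0 := by
      refine sum_eq_zero fun S hS => ?_
      rw [eX, if_neg]
      simp
    rw [card_insert_of_notMem hx]
    by_cases m1 : x ∈ T <;> by_cases m2 : x - 1 ∈ T
    · have hT : T = insert x (insert (x - 1) T₁) := by
        ext z; simp only [hT₁, mem_insert, mem_erase]; grind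
      have hc := cov {x, x - 1} (by intro; simp; tauto)
      have : ({x, x - 1} ∪ T₁ : Finset ℕ) = T := by
        rw [hT, insert_union, singleton_union]
      rw [this, if_neg (by simp), card_pair hxx] at hc
      rw [hc, hT, sum_powerset_insert (by simp [hxx, hx1]), sum_powerset_insert hx2,
        sum_powerset_insert hx2, s0, s1, s2, s3, ← hi]
      ring
    · have hT : T = insert x T₁ := by
        ext z; simp only [hT₁, mem_insert, mem_erase]; grind
      have hc := cov {x} (by simp)
      have : ({x} ∪ T₁ : Finset ℕ) = T := by rw [hT, singleton_union]
      rw [this, if_neg (by simp), card_singleton] at hc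
      rw [hc, hT, sum_powerset_insert hx1, s0, s1, ← hi]
      ring
    · have hT : T = insert (x - 1) T₁ := by
        ext z; simp only [hT₁, mem_insert, mem_erase]; grind
      have hc := cov {x - 1} (by simp)
      have : ({x - 1} ∪ T₁ : Finset ℕ) = T := by rw [hT, singleton_union]
      rw [this, if_neg (by simp), card_singleton] at hc
      rw [hc, hT, sum_powerset_insert hx2, s0, s2, ← hi]
      ring
    · have hT : T = T₁ := by
        ext z; simp only [hT₁, mem_erase]; grind
      have hc := cov ∅ (by simp)
      rw [empty_union, ← hT, if_pos rfl] at hc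
      rw [hc, hT, s0, mul_zero]

theorem RightSparse.mono {n : ℕ} {S T : Finset ℕ} (hS : RightSparse n S) (h : T ⊆ S) :
    RightSparse n T :=
  ⟨h.trans hS.1, fun hn => hS.2.1 (h hn), fun i hi hi' => hS.2.2 i (h hi) (h hi')⟩

/-- The sets counted are the `|X|`-subsets of `S₀`, the elements of `S` whose interval meets `X`. By
sparseness `S₀` is in bijection with a subset `X₀` of `X`, so the count is a binomial coefficient
equal to 1 if `X₀ = X` and to 0 otherwise. As `S` has no consecutive elements, meeting `{x - 1, x}`
is the same as meeting it exactly once. -/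
theorem sum_blockInd {n : ℕ} {X S : Finset ℕ} (hX : LeftSparse n X) (hS : RightSparse n S) :
    ∑ T ∈ S.powerset, blockInd R X T = xorInd R X S := by
  classical
  set S₀ := S.filter fun i => i ∈ X ∨ i + 1 ∈ X with hS₀
  set X₀ := X.filter fun x => x - 1 ∈ S ∨ x ∈ S with hX₀
  have hpos : ∀ x ∈ X, 1 ≤ x := fun x hx => (mem_Icc.1 (hX.1 hx)).1
  have hcard : #S₀ = #X₀ := by
    refine card_bij (fun i _ => if i ∈ X then i else i + 1) ?_ ?_ ?_
    · intro i hi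
      simp only [hS₀, mem_filter] at hi
      simp only [hX₀, mem_filter]
      split_ifs with h
      · exact ⟨h, Or.inr hi.1⟩
      · exact ⟨hi.2.resolve_left h, Or.inl hi.1⟩
    · intro i hi j hj h
      simp only [hS₀, mem_filter] at hi hj
      have h1 := hS.2.2 i hi.1
      have h2 := hS.2.2 j hj.1
      split_ifs at h
      · exact h
      · exact absurd (h ▸ hi.1) h2
      · exact absurd (h ▸ hj.1) h1
      · omega
    · intro x hx
      simp only [hX₀, mem_filter] at hx
      obtain ⟨hxX, hx | hx⟩ := hx
      · have h1 := hpos x hxX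
        refine ⟨x - 1, ?_, ?_⟩
        · simp only [hS₀, mem_filter]
          exact ⟨hx, Or.inr (by rwa [Nat.sub_add_cancel h1])⟩
        · rw [if_neg (hX.2.2 x hxX), Nat.sub_add_cancel h1]
      · exact ⟨x, by simp [hS₀, hx, hxX], by simp [hxX]⟩
  have hfilter : (S.powerset.filter fun T => #X = #T ∧ Blocks (intervals T) X) =
      powersetCard #X S₀ := by
    ext T
    simp only [mem_filter, mem_powerset, mem_powersetCard, blocks_intervals, hS₀, subset_iff]
    constructor
    · rintro ⟨h1, h2, h3⟩
      exact ⟨fun i hi => ⟨h1 hi, h3 i hi⟩, h2.symm⟩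
    · rintro ⟨h1, h2⟩
      exact ⟨fun i hi => (h1 hi).1, h2.symm, fun i hi => (h1 hi).2⟩
  simp only [blockInd]
  rw [← sum_filter, hfilter, sum_const, card_powersetCard, hcard, nsmul_one, xorInd]
  have hiff : (∀ x ∈ X, (x - 1 ∈ S ↔ x ∉ S)) ↔ X₀ = X := by
    rw [hX₀, filter_eq_self]
    refine forall₂_congr fun x hx => ?_
    have h1 := hpos x hx
    have : x - 1 ∈ S → x ∉ S := fun h h' => hS.2.2 _ h (by rwa [Nat.sub_add_cancel h1])
    tauto
  simp only [hiff]
  have hsub : X₀ ⊆ X := filter_subset _ _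
  split_ifs with h
  · rw [h]; simp
  · have : #X₀ < #X := card_lt_card (hsub.ssubset_of_ne h)
    rw [Nat.choose_eq_zero_of_lt this]; simp

variable {R}

/-- Each `i ∈ S` selects `i + 1` if it lies in `X`, and `i` otherwise. By sparseness the selection
is injective, and by cardinality it exhausts `X`; so `X` arises from `S + 1` by lowering some
elements by one. -/
theorem sum_lt_sum_of_blocks {n : ℕ} {X S : Finset ℕ} (hS : RightSparse n S) (hc : #X = #S)
    (hb : Blocks (intervals S) X) (hne : X ≠ S.image (· + 1)) :
    ∑ x ∈ X, x < ∑ x ∈ S.image (· + 1), x := by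
  rw [blocks_intervals] at hb
  set φ : ℕ → ℕ := fun i => if i + 1 ∈ X then i + 1 else i with hφ
  have hinj : Set.InjOn φ S := by
    intro i hi j hj h
    have h1 := hS.2.2 i hi
    have h2 := hS.2.2 j hj
    simp only [hφ] at h
    split_ifs at h
    · omega
    · exact absurd (h ▸ hj) h1
    · exact absurd (h ▸ hi) h2
    · exact h
  have himg : S.image φ = X := by
    refine eq_of_subset_of_card_le ?_ (by rw [card_image_of_injOn hinj, hc])
    intro x hx
    obtain ⟨i, hi, rfl⟩ := mem_image.1 hx
    simp only [hφ]
    split_ifs with h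
    · exact h
    · exact (hb i hi).resolve_right h
  rw [sum_image (by intro; simp), ← himg, sum_image hinj]
  refine sum_lt_sum (fun i _ => by simp only [hφ]; split_ifs <;> omega) ?_
  by_contra! h
  apply hne
  rw [← himg]
  refine image_congr fun i hi => ?_
  have := h i hi
  simp only [hφ] at this ⊢
  split_ifs at this ⊢
  · rfl
  · omega

theorem blocks_image_succ (S : Finset ℕ) : Blocks (intervals S) (S.image (· + 1)) := by
  rw [blocks_intervals]
  exact fun i hi => Or.inr (mem_image_of_mem _ hi)

theorem blockInd_image_succ (S : Finset ℕ) : blockInd R (S.image (· + 1)) S = 1 := by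
  rw [blockInd, if_pos]
  exact ⟨card_image_of_injective _ (add_left_injective 1), blocks_image_succ S⟩

theorem blockInd_eq_zero {n : ℕ} {X S : Finset ℕ} (hS : RightSparse n S)
    (hne : X ≠ S.image (· + 1)) (h : ∑ x ∈ S.image (· + 1), x ≤ ∑ x ∈ X, x) :
    blockInd R X S = 0 := by
  rw [blockInd, if_neg]
  rintro ⟨h1, h2⟩
  exact absurd (sum_lt_sum_of_blocks hS h1 h2 hne) (not_lt.2 h)

/-- Induction on the sum of the elements. If `T` is not right sparse, some `t ∈ T` has `t + 1` in `T
∪ {n + 1}`. The relation for `T \ {t}` and the gap ending at `t + 1` expresses `f T` by values at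
sets with a smaller sum. -/
theorem DehnSommerville.eq_zero {n : ℕ} {f : Finset ℕ → R} (hf : DehnSommerville n f)
    (h : ∀ T, RightSparse n T → f T = 0) {T : Finset ℕ} (hT : T ⊆ Icc 1 n) : f T = 0 := by
  induction hN : ∑ x ∈ T, x using Nat.strong_induction_on generalizing T with
  | _ N ih =>
    subst hN
    by_cases hsp : RightSparse n T
    · exact h T hsp
    obtain ⟨t, ht, htk⟩ : ∃ t ∈ T, t = n ∨ t + 1 ∈ T := by
      by_contra! hcon
      exact hsp ⟨hT, fun hn => (hcon n hn).1 rfl, fun i hi => (hcon i hi).2⟩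
    have htn := mem_Icc.1 (hT ht)
    set T' := T.erase t with hT'
    have hT'n : T' ⊆ Icc 1 n := (erase_subset _ _).trans hT
    have htT' : t ∉ T' := notMem_erase _ _
    have hins : insert t T' = T := insert_erase ht
    have hsum : ∑ x ∈ T, x = t + ∑ x ∈ T', x := by rw [← hins, sum_insert htT']
    -- The predecessor of `t` in `T ∪ {0}`: the supremum of the empty set is 0, the left end
    -- required by the relations.
    set i := (T.filter (· < t)).sup id with hi
    have hit : i < t := by
      rw [hi, Finset.sup_lt_iff (by rw [Nat.bot_eq_zero]; omega)]
      intro b hb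
      exact (mem_filter.1 hb).2
    have hi' : i = 0 ∨ i ∈ T' := by
      rcases (T.filter (· < t)).eq_empty_or_nonempty with h0 | h0
      · left; rw [hi, h0]; rfl
      · right
        obtain ⟨b, hb, hbi⟩ := exists_mem_eq_sup _ h0 id
        rw [hi, hbi]
        rw [mem_filter] at hb
        exact mem_erase.2 ⟨hb.2.ne, hb.1⟩
    have hgap : ∀ j ∈ T', ¬ (i < j ∧ j < t + 1) := by
      rintro j hj ⟨h1, h2⟩
      rw [hT', mem_erase] at hj
      have : j ≤ i := le_sup (f := id) (mem_filter.2 ⟨hj.2, by omega⟩)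
      omega
    have key := hf T' hT'n i (t + 1) (by omega) (by omega) hi'
      (htk.imp (fun h => by omega) fun h => mem_erase.2 ⟨by omega, h⟩) hgap
    rw [sum_eq_single_of_mem t (by rw [mem_Icc]; omega)] at key
    · rw [hins, inter_eq_left.2 hT] at key
      -- The sign is its own inverse, so no division is needed in `R`.
      have := congrArg (fun z => (-1) ^ t * z) key
      simpa [← mul_assoc, ← mul_pow] using this
    · intro j hj hjt
      rw [mem_Icc] at hj
      rw [ih _ _ inter_subset_right rfl, mul_zero]
      by_cases hj2 : j = t + 1
      · have : insert j T' ∩ Icc 1 n ⊆ T' := by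
          intro z hz
          rw [mem_inter, mem_insert, mem_Icc] at hz
          rcases hz.1 with rfl | hz'
          · rcases htk with h1 | h1
            · omega
            · exact mem_erase.2 ⟨by omega, hj2 ▸ h1⟩
          · exact hz'
        have := sum_le_sum_of_subset (f := fun x : ℕ => x) this
        omega
      · have h1 : ∑ x ∈ insert j T' ∩ Icc 1 n, x ≤ ∑ x ∈ insert j T', x :=
          sum_le_sum_of_subset inter_subset_left
        have h2 : ∑ x ∈ insert j T', x ≤ j + ∑ x ∈ T', x := by
          by_cases hjT : j ∈ T'
          · rw [insert_eq_self.2 hjT]; omega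
          · rw [sum_insert hjT]
        omega

end Indicators

/-! ### `cd`-words of degree `n` as left sparse subsets of `[n]` -/

theorem CDWord.induction_right {p : CDWord → Prop} (one : p 1)
    (mul_c : ∀ w, p w → p (w * FreeMonoid.of CD.c))
    (mul_d : ∀ w, p w → p (w * FreeMonoid.of CD.d)) (w : CDWord) : p w := by
  have : ∀ l : List CD, p (FreeMonoid.ofList l) := by
    intro l
    induction l using List.reverseRecOn with
    | nil => exact one
    | append_singleton l x ih =>
      rw [FreeMonoid.ofList_append]
      cases x
      exacts [mul_c _ ih, mul_d _ ih]
  exact this w.toList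

theorem dEnds_append (p : ℕ) (l l' : List CD) :
    dEnds p (l ++ l') = dEnds p l ∪ dEnds (p + (l.map CD.deg).sum) l' := by
  induction l generalizing p with
  | nil => simp [dEnds]
  | cons x l ih => cases x <;> simp [dEnds, ih, CD.deg, add_assoc]

theorem deg_one : deg 1 = 0 := rfl

theorem deg_mul_c (w : CDWord) : deg (w * FreeMonoid.of CD.c) = deg w + 1 := by
  simp [deg, CD.deg]

theorem deg_mul_d (w : CDWord) : deg (w * FreeMonoid.of CD.d) = deg w + 2 := by
  simp [deg, CD.deg]

theorem wordSet_one : wordSet 1 = ∅ := rfl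

theorem wordSet_mul_c (w : CDWord) : wordSet (w * FreeMonoid.of CD.c) = wordSet w := by
  simp [wordSet, dEnds_append, dEnds]

theorem wordSet_mul_d (w : CDWord) :
    wordSet (w * FreeMonoid.of CD.d) = insert (deg w + 2) (wordSet w) := by
  rw [wordSet, FreeMonoid.toList_mul, FreeMonoid.toList_of, dEnds_append, union_comm]
  simp [dEnds, deg, wordSet]

theorem LeftSparse.mono_right {n n' : ℕ} {X : Finset ℕ} (hX : LeftSparse n X) (h : n ≤ n') :
    LeftSparse n' X :=
  ⟨hX.1.trans (Icc_subset_Icc_right h), hX.2⟩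

theorem leftSparse_wordSet (w : CDWord) : LeftSparse (deg w) (wordSet w) := by
  induction w using CDWord.induction_right with
  | one => simp [LeftSparse, wordSet_one]
  | mul_c w ih =>
    rw [wordSet_mul_c, deg_mul_c]
    exact ih.mono_right (Nat.le_succ _)
  | mul_d w ih =>
    rw [wordSet_mul_d, deg_mul_d]
    have hle : ∀ x ∈ wordSet w, 1 ≤ x ∧ x ≤ deg w := fun x hx => mem_Icc.1 (ih.1 hx)
    refine ⟨insert_subset (by rw [mem_Icc]; omega) (ih.mono_right (by omega)).1, ?_, ?_⟩
    · rw [mem_insert, not_or]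
      exact ⟨by omega, ih.2.1⟩
    · intro i hi hi'
      rw [mem_insert] at hi hi'
      rcases hi with rfl | hi <;> rcases hi' with hi' | hi'
      · omega
      · have := hle _ hi'
        omega
      · have := hle _ hi
        omega
      · exact ih.2.2 i hi hi'

theorem wordSet_subset (w : CDWord) : wordSet w ⊆ Icc 1 (deg w) := (leftSparse_wordSet w).1

theorem dDeg_eq_card (w : CDWord) : dDeg w = #(wordSet w) := by
  induction w using CDWord.induction_right with
  | one => rfl
  | mul_c w ih =>
    rw [wordSet_mul_c, ← ih]
    simp [dDeg]
  | mul_d w ih =>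
    rw [wordSet_mul_d, card_insert_of_notMem, ← ih]
    · simp [dDeg]
    · intro h
      have := mem_Icc.1 (wordSet_subset w h)
      omega

theorem deg_mem_wordSet_mul_d (w : CDWord) :
    deg (w * FreeMonoid.of CD.d) ∈ wordSet (w * FreeMonoid.of CD.d) := by
  rw [wordSet_mul_d, deg_mul_d]
  exact mem_insert_self _ _

theorem deg_notMem_wordSet_mul_c (w : CDWord) :
    deg (w * FreeMonoid.of CD.c) ∉ wordSet (w * FreeMonoid.of CD.c) := by
  rw [wordSet_mul_c, deg_mul_c]
  intro h
  have := mem_Icc.1 (wordSet_subset w h)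
  omega

/-- The last letter can be read off: it is `d` exactly if the degree belongs to the set. -/
theorem eq_of_wordSet_eq {w w' : CDWord} (hd : deg w = deg w') (hs : wordSet w = wordSet w') :
    w = w' := by
  induction w using CDWord.induction_right generalizing w' with
  | one =>
    induction w' using CDWord.induction_right with
    | one => rfl
    | mul_c w' _ => rw [deg_one, deg_mul_c] at hd; omega
    | mul_d w' _ => rw [deg_one, deg_mul_d] at hd; omega
  | mul_c w ih =>
    induction w' using CDWord.induction_right with
    | one => rw [deg_one, deg_mul_c] at hd; omega
    | mul_c w' _ =>
      rw [ih (w' := w') (by simpa [deg_mul_c] using hd) (by simpa [wordSet_mul_c] using hs)]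
    | mul_d w' _ =>
      exact absurd (hs ▸ hd ▸ deg_mem_wordSet_mul_d w') (deg_notMem_wordSet_mul_c w)
  | mul_d w ih =>
    induction w' using CDWord.induction_right with
    | one => rw [deg_one, deg_mul_d] at hd; omega
    | mul_c w' _ =>
      exact absurd (hs ▸ hd ▸ deg_mem_wordSet_mul_d w) (deg_notMem_wordSet_mul_c w')
    | mul_d w' _ =>
      have hd' : deg w = deg w' := by simpa [deg_mul_d] using hd
      rw [ih (w' := w') hd']
      have h1 : deg w + 2 ∉ wordSet w := fun h => by
        have := mem_Icc.1 (wordSet_subset w h)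
        omega
      have h2 : deg w + 2 ∉ wordSet w' := fun h => by
        have := mem_Icc.1 (wordSet_subset w' h)
        omega
      rw [wordSet_mul_d, wordSet_mul_d, ← hd'] at hs
      rw [← erase_insert h1, hs, erase_insert h2]

/-- The word is built from its end: a `d` uses up `n` and `n - 1`, which is possible since `n ∈ X`
excludes `n = 1` and `n - 1 ∈ X`; otherwise a `c` uses up `n`. -/
theorem exists_wordSet_eq {n : ℕ} {X : Finset ℕ} (hX : LeftSparse n X) :
    ∃ w, deg w = n ∧ wordSet w = X := by
  induction n using Nat.strong_induction_on generalizing X with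
  | _ n ih =>
    by_cases hn : n ∈ X
    · have h1 := mem_Icc.1 (hX.1 hn)
      have h2 : n ≠ 1 := fun h => hX.2.1 (h ▸ hn)
      have h3 := hX.2.2 n hn
      obtain ⟨w, hw, hs⟩ := ih (n - 2) (by omega) (X := X.erase n) ⟨fun x hx => by
          rw [mem_erase] at hx
          have := mem_Icc.1 (hX.1 hx.2)
          have h4 : x ≠ n - 1 := fun h => h3 (h ▸ hx.2)
          rw [mem_Icc]
          omega, fun h => hX.2.1 (mem_of_mem_erase h), fun i hi hi' =>
          hX.2.2 i (mem_of_mem_erase hi) (mem_of_mem_erase hi')⟩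
      have h5 : n - 2 + 2 = n := by omega
      refine ⟨w * FreeMonoid.of CD.d, by rw [deg_mul_d, hw, h5], ?_⟩
      rw [wordSet_mul_d, hw, hs, h5, insert_erase hn]
    · rcases Nat.eq_zero_or_pos n with rfl | hpos
      · refine ⟨1, rfl, ?_⟩
        have := hX.1
        rw [wordSet_one]
        simpa [eq_comm] using this
      · obtain ⟨w, hw, hs⟩ := ih (n - 1) (by omega) (X := X) ⟨fun x hx => by
          have := mem_Icc.1 (hX.1 hx)
          have h4 : x ≠ n := fun h => hn (h ▸ hx)
          rw [mem_Icc]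
          omega, hX.2⟩
        refine ⟨w * FreeMonoid.of CD.c, by rw [deg_mul_c, hw]; omega, ?_⟩
        rw [wordSet_mul_c, hs]

theorem finite_deg_eq (n : ℕ) : {w : CDWord | deg w = n}.Finite := by
  refine Set.Finite.of_finite_image (f := wordSet)
    ((Set.finite_Iic (Icc 1 n)).subset ?_) ?_
  · rintro _ ⟨w, rfl, rfl⟩
    exact wordSet_subset w
  · rintro w rfl w' hw' h
    exact eq_of_wordSet_eq (Eq.symm hw') h

/-- The `cd`-words of degree `n`. -/
noncomputable def wordsOfDeg (n : ℕ) : Finset CDWord := (finite_deg_eq n).toFinset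

@[simp] theorem mem_wordsOfDeg {n : ℕ} {w : CDWord} : w ∈ wordsOfDeg n ↔ deg w = n := by
  simp [wordsOfDeg]

theorem RightSparse.leftSparse_image_succ {n : ℕ} {S : Finset ℕ} (hS : RightSparse n S) :
    LeftSparse n (S.image (· + 1)) := by
  refine ⟨?_, ?_, ?_⟩
  · intro x hx
    obtain ⟨i, hi, rfl⟩ := mem_image.1 hx
    have := mem_Icc.1 (hS.1 hi)
    have : i ≠ n := fun h => hS.2.1 (h ▸ hi)
    rw [mem_Icc]
    omega
  · intro h
    obtain ⟨i, hi, h1⟩ := mem_image.1 h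
    have := mem_Icc.1 (hS.1 hi)
    omega
  · intro x hx hx'
    obtain ⟨i, hi, rfl⟩ := mem_image.1 hx
    obtain ⟨j, hj, h⟩ := mem_image.1 hx'
    simp only [Nat.add_sub_cancel] at h
    exact hS.2.2 j hj (h ▸ hi)

theorem LeftSparse.exists_image_succ {n : ℕ} {X : Finset ℕ} (hX : LeftSparse n X) :
    ∃ S, RightSparse n S ∧ S.image (· + 1) = X := by
  have hpos : ∀ x ∈ X, 2 ≤ x ∧ x ≤ n := by
    intro x hx
    have := mem_Icc.1 (hX.1 hx)
    have : x ≠ 1 := fun h => hX.2.1 (h ▸ hx)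
    omega
  refine ⟨X.image (· - 1), ⟨?_, ?_, ?_⟩, ?_⟩
  · intro y hy
    obtain ⟨x, hx, rfl⟩ := mem_image.1 hy
    have := hpos x hx
    rw [mem_Icc]
    omega
  · intro h
    obtain ⟨x, hx, h1⟩ := mem_image.1 h
    have := hpos x hx
    omega
  · intro y hy hy'
    obtain ⟨x, hx, rfl⟩ := mem_image.1 hy
    obtain ⟨x', hx', h⟩ := mem_image.1 hy'
    have h1 := hpos x hx
    have h2 := hpos x' hx'
    apply hX.2.2 x' hx'
    have : x' - 1 = x := by omega
    rwa [this]
  · rw [image_image]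
    refine (image_congr fun x hx => ?_).trans image_id
    have := hpos x hx
    simp only [Function.comp_apply, id]
    omega

/-! ### The unitriangular system and the expansion of Dehn–Sommerville functions -/

section Triangular

variable {R : Type*} [CommRing R]

/-- Back substitution, by induction on the sum of `S_w`: in the equation for the `S` with `S + 1 =
S_w`, the other words either have a smaller sum or do not occur. -/
theorem eq_zero_of_sum_blockInd_eq_zero {n : ℕ} {κ : CDWord → R}
    (h : ∀ S, RightSparse n S → ∑ w ∈ wordsOfDeg n, κ w * blockInd R (wordSet w) S = 0)
    {w : CDWord} (hw : deg w = n) : κ w = 0 := by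
  induction hN : ∑ x ∈ wordSet w, x using Nat.strong_induction_on generalizing w with
  | _ N ih =>
    subst hN
    obtain ⟨S, hS, hSw⟩ := (hw ▸ leftSparse_wordSet w : LeftSparse n _).exists_image_succ
    have h1 := h S hS
    rw [sum_eq_single_of_mem w (mem_wordsOfDeg.2 hw)] at h1
    · rwa [← hSw, blockInd_image_succ, mul_one] at h1
    · intro w' hw' hne
      rw [mem_wordsOfDeg] at hw'
      by_cases hlt : ∑ x ∈ wordSet w', x < ∑ x ∈ wordSet w, x
      · rw [ih _ hlt hw' rfl, zero_mul]
      · rw [blockInd_eq_zero hS, mul_zero]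
        · rw [hSw]
          exact fun h => hne (eq_of_wordSet_eq (hw'.trans hw.symm) h)
        · rw [hSw]
          exact not_lt.1 hlt

theorem exists_sum_blockInd_eq (n : ℕ) (t : Finset ℕ → R) : ∃ κ : CDWord → R,
    ∀ S, RightSparse n S → ∑ w ∈ wordsOfDeg n, κ w * blockInd R (wordSet w) S = t S := by
  have key : ∀ N, ∃ κ : CDWord → R, ∀ S, RightSparse n S → ∑ x ∈ S.image (· + 1), x < N →
      ∑ w ∈ wordsOfDeg n, κ w * blockInd R (wordSet w) S = t S := by
    intro N
    induction N with
    | zero => exact ⟨0, fun S _ h => absurd h (Nat.not_lt_zero _)⟩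
    | succ N ih =>
      obtain ⟨κ, hκ⟩ := ih
      -- The defect of the equation matched with `w`, for words of sum `N` only. By triangularity
      -- this correction leaves the equations of smaller sum intact and does not mix those of sum
      -- `N`.
      set δ : CDWord → R := fun w => if ∑ x ∈ wordSet w, x = N then
        t ((wordSet w).image (· - 1)) - ∑ w' ∈ wordsOfDeg n, κ w' *
          blockInd R (wordSet w') ((wordSet w).image (· - 1)) else 0 with hδ
      refine ⟨fun w => κ w + δ w, fun S hS hSN => ?_⟩
      simp only [add_mul]
      rw [sum_add_distrib]
      rcases Nat.lt_succ_iff_lt_or_eq.1 hSN with hlt | heq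
      · rw [hκ S hS hlt, sum_eq_zero, add_zero]
        intro w _
        simp only [hδ]
        split_ifs with hw
        · rw [blockInd_eq_zero hS, mul_zero]
          · intro h
            rw [h] at hw
            omega
          · omega
        · rw [zero_mul]
      · obtain ⟨v, hv, hvS⟩ := exists_wordSet_eq hS.leftSparse_image_succ
        rw [sum_eq_single_of_mem (f := fun w => δ w * _) v (mem_wordsOfDeg.2 hv)]
        · have : (S.image (· + 1)).image (· - 1) = S := by
            rw [image_image]
            exact (image_congr fun x _ => by simp).trans image_id
          rw [hvS, blockInd_image_succ, mul_one]
          simp only [hδ]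
          rw [hvS, this, if_pos heq]
          ring
        · intro w hw hne
          simp only [hδ]
          split_ifs with hwN
          · rw [blockInd_eq_zero hS, mul_zero]
            · rw [← hvS]
              exact fun h => hne (eq_of_wordSet_eq ((mem_wordsOfDeg.1 hw).trans hv.symm) h)
            · omega
          · rw [zero_mul]
  obtain ⟨κ, hκ⟩ := key (∑ x ∈ Icc 1 n, x + 1)
  refine ⟨κ, fun S hS => hκ S hS (Nat.lt_succ_of_le ?_)⟩
  exact sum_le_sum_of_subset hS.leftSparse_image_succ.1

/-- `f` is the flag `f`-vector of the linear combination of `cd`-words of degree `n` with the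
coefficients `κ`. -/
def IsFlagF (n : ℕ) (κ : CDWord → R) (f : Finset ℕ → R) : Prop :=
  ∀ T ⊆ Icc 1 n, f T =
    ∑ w ∈ wordsOfDeg n, κ w * ∑ S ∈ T.powerset, xorInd R (wordSet w) S

theorem IsFlagF.moebius_eq {n : ℕ} {κ : CDWord → R} {f : Finset ℕ → R} (h : IsFlagF n κ f)
    {S : Finset ℕ} (hS : S ⊆ Icc 1 n) :
    moebius f S = ∑ w ∈ wordsOfDeg n, κ w * xorInd R (wordSet w) S := by
  refine moebius_eq_of_sum (g := fun S => ∑ w ∈ wordsOfDeg n, κ w * xorInd R (wordSet w) S)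
    fun S' hS' => ?_
  rw [sum_comm, h S' (hS'.trans hS)]
  exact sum_congr rfl fun w _ => by rw [mul_sum]

theorem isFlagF_of_moebius_eq {n : ℕ} {κ : CDWord → R} {f : Finset ℕ → R}
    (h : ∀ S ⊆ Icc 1 n, moebius f S = ∑ w ∈ wordsOfDeg n, κ w * xorInd R (wordSet w) S) :
    IsFlagF n κ f := by
  intro T hT
  rw [← sum_moebius f T,
    sum_congr rfl fun S hS => h S ((mem_powerset.1 hS).trans hT), sum_comm]
  exact sum_congr rfl fun w _ => by rw [mul_sum]

theorem sum_sum_blockInd {n : ℕ} (κ : CDWord → R) {S : Finset ℕ} (hS : RightSparse n S) :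
    ∑ U ∈ S.powerset, ∑ w ∈ wordsOfDeg n, κ w * blockInd R (wordSet w) U =
      ∑ w ∈ wordsOfDeg n, κ w * xorInd R (wordSet w) S := by
  rw [sum_comm]
  refine sum_congr rfl fun w hw => ?_
  rw [mem_wordsOfDeg] at hw
  rw [← mul_sum, sum_blockInd R (hw ▸ leftSparse_wordSet w : LeftSparse n _) hS]

theorem IsFlagF.moebius_moebius_eq {n : ℕ} {κ : CDWord → R} {f : Finset ℕ → R}
    (h : IsFlagF n κ f) {S : Finset ℕ} (hS : RightSparse n S) :
    moebius (moebius f) S = ∑ w ∈ wordsOfDeg n, κ w * blockInd R (wordSet w) S := by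
  refine moebius_eq_of_sum
    (g := fun S => ∑ w ∈ wordsOfDeg n, κ w * blockInd R (wordSet w) S) fun S' hS' => ?_
  rw [sum_sum_blockInd κ (hS.mono hS'), h.moebius_eq (hS'.trans hS.1)]

theorem two_pow_dDeg_mul_sum_xorInd (w : CDWord) (T : Finset ℕ) :
    2 ^ dDeg w * ∑ S ∈ T.powerset, xorInd R (wordSet w) S = coverCount R (wordSet w) T := by
  rw [dDeg_eq_card]
  refine two_pow_mul_sum_xorInd R (fun h => ?_) (leftSparse_wordSet w).2.2 T
  have := mem_Icc.1 (wordSet_subset w h)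
  omega

/-- The coefficients are chosen to match `k_S`, hence `h_S` and `f_S`, on right sparse sets. The
difference of both sides satisfies the relations and vanishes there, so it vanishes on all subsets
of `[n]`. Working over general `R` gives integral coefficients in the poset case. -/
theorem DehnSommerville.exists_isFlagF [NoZeroDivisors R] [CharZero R] {n : ℕ}
    {f : Finset ℕ → R} (hf : DehnSommerville n f) : ∃ κ : CDWord → R, IsFlagF n κ f := by
  obtain ⟨κ, hκ⟩ := exists_sum_blockInd_eq n (moebius (moebius f))
  refine ⟨κ, fun T hT => ?_⟩
  have hword : ∀ w ∈ wordsOfDeg n,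
      DehnSommerville n fun T => ∑ S ∈ T.powerset, xorInd R (wordSet w) S := by
    intro w hw T hT i k hik hk hi hk' hgap
    rw [mem_wordsOfDeg] at hw
    have h1 := (hw ▸ leftSparse_wordSet w : LeftSparse n _).dehnSommerville_coverCount (R := R)
      T hT i k hik hk hi hk' hgap
    simp only [← two_pow_dDeg_mul_sum_xorInd, mul_left_comm _ (2 ^ dDeg w : R)] at h1
    rw [← mul_sum] at h1
    -- The relations are known for `coverCount`, which is `2 ^ |w|_d` times the `f`-vector of the
    -- word; this is the only place where the power of 2 is cancelled in `R`.
    exact (mul_eq_zero.1 h1).resolve_left (pow_ne_zero _ two_ne_zero)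
  have hsub : DehnSommerville n fun T => f T -
      ∑ w ∈ wordsOfDeg n, κ w * ∑ S ∈ T.powerset, xorInd R (wordSet w) S := by
    intro T hT i k hik hk hi hk' hgap
    simp only [mul_sub, sum_sub_distrib]
    rw [hf T hT i k hik hk hi hk' hgap, zero_sub, neg_eq_zero]
    simp only [mul_sum (s := wordsOfDeg n)]
    rw [sum_comm]
    refine sum_eq_zero fun w hw => ?_
    have := hword w hw T hT i k hik hk hi hk' hgap
    simp only [mul_left_comm _ (κ w)]
    rw [← mul_sum, this, mul_zero]
  refine sub_eq_zero.1 (hsub.eq_zero (fun T hT => ?_) hT)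
  rw [sub_eq_zero, ← sum_moebius f T]
  have h1 : ∀ S ∈ T.powerset, moebius f S =
      ∑ w ∈ wordsOfDeg n, κ w * xorInd R (wordSet w) S := by
    intro S hS
    have hS' := hT.mono (mem_powerset.1 hS)
    rw [← sum_sum_blockInd κ hS', ← sum_moebius (moebius f) S]
    exact sum_congr rfl fun U hU => (hκ U (hS'.mono (mem_powerset.1 hU))).symm
  rw [sum_congr rfl h1, sum_comm]
  exact sum_congr rfl fun w _ => by rw [mul_sum]

end Triangular

/-! ### The `cd`-index on the peak algebra -/

section Flags

variable {R : Type*} [CommRing R]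

theorem IsFlagF.eq_on {n : ℕ} {κ κ' : CDWord → R} {f f' : Finset ℕ → R} (h : IsFlagF n κ f)
    (h' : IsFlagF n κ' f') (hff' : ∀ T ⊆ Icc 1 n, f T = f' T) {w : CDWord} (hw : deg w = n) :
    κ w = κ' w := by
  have h0 : IsFlagF n (fun w => κ w - κ' w) (0 : Finset ℕ → R) := by
    intro T hT
    simp only [sub_mul, sum_sub_distrib]
    rw [← h T hT, ← h' T hT, hff' T hT, sub_self, Pi.zero_apply]
  refine sub_eq_zero.1 (eq_zero_of_sum_blockInd_eq_zero (κ := fun w => κ w - κ' w)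
    (fun S hS => ?_) hw)
  rw [← h0.moebius_moebius_eq hS]
  simp [moebius]

end Flags

theorem isCDIndex_iff {F : MvPowerSeries ℕ ℚ} {κ : CDWord → ℚ} : IsCDIndex F κ ↔
    ∀ n S, RightSparse n S →
      flagK F n S = ∑ w ∈ wordsOfDeg n, κ w * blockInd ℚ (wordSet w) S := by
  classical
  refine forall₂_congr fun n S => imp_congr_right fun _ => ?_
  have : {w : CDWord | deg w = n ∧ dDeg w = #S ∧ Blocks (intervals S) (wordSet w)} =
      ((wordsOfDeg n).filter fun w => #(wordSet w) = #S ∧ Blocks (intervals S) (wordSet w) :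
        Finset CDWord) := by
    ext w
    simp [dDeg_eq_card]
  rw [this, finsum_mem_coe_finset, sum_filter]
  simp only [blockInd, mul_ite, mul_one, mul_zero]

theorem IsCDIndex.unique {F : MvPowerSeries ℕ ℚ} {κ κ' : CDWord → ℚ} (h : IsCDIndex F κ)
    (h' : IsCDIndex F κ') : κ = κ' := by
  rw [isCDIndex_iff] at h h'
  funext w
  refine sub_eq_zero.1 (eq_zero_of_sum_blockInd_eq_zero (n := deg w)
    (κ := fun w => κ w - κ' w) (fun S hS => ?_) rfl)
  simp only [sub_mul, sum_sub_distrib]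
  rw [← h _ S hS, ← h' _ S hS, sub_self]

theorem isCDIndex_of_isFlagF {F : MvPowerSeries ℕ ℚ} {κ : CDWord → ℚ}
    (h : ∀ n, IsFlagF n κ (flagF F n)) : IsCDIndex F κ :=
  isCDIndex_iff.2 fun n _ hS => (h n).moebius_moebius_eq hS

theorem exists_isFlagF_of_mem_peakAlgebra {F : MvPowerSeries ℕ ℚ} (hF : F ∈ peakAlgebra) :
    ∃ κ : CDWord → ℚ, ∀ n, IsFlagF n κ (flagF F n) := by
  obtain ⟨⟨hq, hc⟩, -⟩ := peakAlgebra_le hF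
  choose κ hκ using fun n => ((mem_cancelling_iff hq).1 hc n).exists_isFlagF
  -- The solutions for the separate degrees are glued: each word takes its coefficient from its own
  -- degree.
  refine ⟨fun w => κ (deg w) w, fun n T hT => ?_⟩
  rw [hκ n T hT]
  refine sum_congr rfl fun w hw => ?_
  change κ n w * _ = κ (deg w) w * _
  rw [mem_wordsOfDeg.1 hw]

/-- The exponent list of a nontrivial monomial is the composition of some subset of some `[n]`; the
empty list is why the constant term needs a separate hypothesis. -/
theorem quasiSymm_ext {F G : MvPowerSeries ℕ ℚ} (hF : F ∈ quasiSymm) (hG : G ∈ quasiSymm)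
    (h0 : MvPowerSeries.constantCoeff F = MvPowerSeries.constantCoeff G)
    (h : ∀ n, ∀ T ⊆ Icc 1 n, flagF F n T = flagF G n T) : F = G := by
  ext m
  rcases eq_or_ne m 0 with rfl | hm
  · simpa using h0
  · have hd : m.degree ≠ 0 := by rwa [ne_eq, Finsupp.degree_eq_zero_iff]
    rw [← sum_exponents] at hd
    obtain ⟨n, hn⟩ := Nat.exists_eq_succ_of_ne_zero hd
    obtain ⟨T, hT, hTm⟩ := exists_comp_eq (exponents_pos m)
      (fun h => hd (by rw [h]; rfl)) hn
    rw [flagF_eq_coeff hF hTm.symm, flagF_eq_coeff hG hTm.symm, h n T hT]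

theorem constantCoeff_thetaSet (n : ℕ) (S : Finset ℕ) :
    MvPowerSeries.constantCoeff (thetaSet n S) = 0 := by
  rw [← MvPowerSeries.coeff_zero_eq_constantCoeff_apply, coeff_thetaSet_of_degree_ne (by simp)]

/-- The coefficients of `Θ_w` are twice `coverCount`, that is `2 ^ (|w|_d + 1)` times the `f`-vector
of the word, which the denominator cancels. -/
theorem isFlagF_sum_theta (A : Finset CDWord) (κ : CDWord → ℚ) (hκ : ∀ w ∉ A, κ w = 0) (n : ℕ) :
    IsFlagF n κ (flagF (∑ w ∈ A, (κ w / 2 ^ (dDeg w + 1)) • theta w) n) := by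
  classical
  intro T hT
  rw [flagF, map_sum]
  have h1 : ∀ w ∈ A, MvPowerSeries.coeff (comp n T).toFinsupp
      ((κ w / 2 ^ (dDeg w + 1)) • theta w) =
      if deg w = n then κ w * ∑ S ∈ T.powerset, xorInd ℚ (wordSet w) S else 0 := by
    intro w _
    rw [MvPowerSeries.coeff_smul]
    change _ * flagF (thetaSet (deg w) (wordSet w)) n T = _
    split_ifs with hw
    · subst hw
      rw [flagF_thetaSet hT, ← two_pow_dDeg_mul_sum_xorInd]
      field_simp
      ring
    · rw [flagF_thetaSet_of_ne hT hw, mul_zero]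
  rw [sum_congr rfl h1, ← sum_filter]
  refine sum_subset (fun w hw => mem_wordsOfDeg.2 (mem_filter.1 hw).2) fun w hw hwA => ?_
  rw [hκ w fun h => hwA (mem_filter.2 ⟨h, mem_wordsOfDeg.1 hw⟩), zero_mul]

theorem sum_smul_theta_mem_quasiSymm (A : Finset CDWord) (c : CDWord → ℚ) :
    ∑ w ∈ A, c w • theta w ∈ quasiSymm :=
  sum_mem fun _ _ => Subalgebra.smul_mem _ (thetaSet_mem_quasiSymm _ _) _

theorem constantCoeff_sum_smul_theta (A : Finset CDWord) (c : CDWord → ℚ) :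
    MvPowerSeries.constantCoeff (∑ w ∈ A, c w • theta w) = 0 := by
  rw [map_sum]
  refine sum_eq_zero fun w _ => ?_
  rw [MvPowerSeries.constantCoeff_smul, theta, constantCoeff_thetaSet, smul_zero]

theorem flagF_zero (n : ℕ) (T : Finset ℕ) : flagF 0 n T = 0 := by simp [flagF]

theorem linearIndependent_theta : LinearIndependent ℚ theta := by
  rw [linearIndependent_iff]
  intro l hl
  set κ : CDWord → ℚ := fun w => l w * 2 ^ (dDeg w + 1) with hκ
  have h1 := isFlagF_sum_theta l.support κ fun w hw => by
    simp [hκ, Finsupp.notMem_support_iff.1 hw]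
  have h2 : ∑ w ∈ l.support, (κ w / 2 ^ (dDeg w + 1)) • theta w = 0 := by
    rw [← hl, Finsupp.linearCombination_apply, Finsupp.sum]
    refine sum_congr rfl fun w _ => ?_
    rw [hκ]
    simp
  ext w
  have h3 : IsFlagF (deg w) (0 : CDWord → ℚ) (0 : Finset ℕ → ℚ) := fun T _ => by simp
  have h4 := (h1 (deg w)).eq_on h3 (fun T _ => by rw [h2, flagF_zero, Pi.zero_apply]) rfl
  simpa [hκ] using h4

theorem theta_mem_peakAlgebra (w : CDWord) : theta w ∈ peakAlgebra :=
  Algebra.subset_adjoin ⟨deg w, wordSet w, leftSparse_wordSet w, rfl⟩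

theorem existsUnique_isCDIndex {F : MvPowerSeries ℕ ℚ} (hF : F ∈ peakAlgebra) :
    ∃! κ : CDWord → ℚ, IsCDIndex F κ := by
  obtain ⟨κ, hκ⟩ := exists_isFlagF_of_mem_peakAlgebra hF
  exact ⟨κ, isCDIndex_of_isFlagF hκ, fun κ' h => h.unique (isCDIndex_of_isFlagF hκ)⟩

theorem finite_support_of_isFlagF {F : MvPowerSeries ℕ ℚ} (hF : F ∈ boundedDegree)
    {κ : CDWord → ℚ} (hκ : ∀ n, IsFlagF n κ (flagF F n)) : (Function.support κ).Finite := by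
  classical
  obtain ⟨N, hN⟩ := mem_boundedDegree.1 hF
  refine ((range N).biUnion wordsOfDeg).finite_toSet.subset fun w hw => ?_
  simp only [coe_biUnion, Set.mem_iUnion, mem_coe, mem_range, mem_wordsOfDeg]
  refine ⟨deg w, ?_, rfl⟩
  by_contra hle
  apply hw
  have h3 : IsFlagF (deg w) (0 : CDWord → ℚ) (0 : Finset ℕ → ℚ) := fun T _ => by simp
  refine (hκ (deg w)).eq_on h3 (fun T hT => ?_) rfl
  rw [flagF, hN, Pi.zero_apply]
  rw [degree_toFinsupp_comp hT]
  omega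

theorem eq_sum_theta {F : MvPowerSeries ℕ ℚ} (hF : F ∈ peakAlgebra)
    (h0 : MvPowerSeries.constantCoeff F = 0) {κ : CDWord → ℚ} (hκ : IsCDIndex F κ) :
    (Function.support (c2dCoeff κ)).Finite ∧
      F = (1 / 2 : ℚ) • ∑ᶠ w, c2dCoeff κ w • theta w := by
  obtain ⟨κ', hκ'⟩ := exists_isFlagF_of_mem_peakAlgebra hF
  obtain rfl : κ = κ' := hκ.unique (isCDIndex_of_isFlagF hκ')
  obtain ⟨⟨hq, -⟩, hb⟩ := peakAlgebra_le hF
  have hfin := finite_support_of_isFlagF hb hκ'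
  have hsub : Function.support (c2dCoeff κ) ⊆ Function.support κ := by
    intro w hw h
    exact hw (by simp [c2dCoeff, h])
  refine ⟨hfin.subset hsub, ?_⟩
  have hsum : (1 / 2 : ℚ) • ∑ᶠ w, c2dCoeff κ w • theta w =
      ∑ w ∈ hfin.toFinset, (κ w / 2 ^ (dDeg w + 1)) • theta w := by
    rw [finsum_eq_sum_of_support_subset (s := hfin.toFinset), smul_sum]
    · refine sum_congr rfl fun w _ => ?_
      rw [smul_smul, c2dCoeff]
      congr 1
      field_simp
      ring
    · intro w hw
      rw [Set.Finite.coe_toFinset]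
      exact hsub fun h => hw (by simp [h])
  rw [hsum]
  refine quasiSymm_ext hq (sum_smul_theta_mem_quasiSymm _ _) ?_ fun n T hT => ?_
  · rw [h0, constantCoeff_sum_smul_theta]
  · rw [hκ' n T hT, isFlagF_sum_theta hfin.toFinset κ (fun w hw => by simpa using hw) n T hT]

/-! ### The substitution `c = a + b`, `d = ab + ba` -/

/-- The noncommutative monomial `u_S` of degree `n`. -/
noncomputable def abMonomial (n : ℕ) (S : Finset ℕ) : MonoidAlgebra ℤ (FreeMonoid AB) :=
  MonoidAlgebra.of ℤ (FreeMonoid AB) (abWord n S)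

theorem abWord_succ (n : ℕ) (S : Finset ℕ) :
    abWord (n + 1) S = abWord n S * FreeMonoid.of (if n + 1 ∈ S then AB.b else AB.a) := by
  rw [abWord, List.range_succ, List.map_append, FreeMonoid.ofList_append]
  rfl

theorem abWord_congr {n : ℕ} {S S' : Finset ℕ} (h : ∀ i ∈ Icc 1 n, i ∈ S ↔ i ∈ S') :
    abWord n S = abWord n S' := by
  rw [abWord, abWord]
  congr 1
  refine List.map_congr_left fun i hi => ?_
  rw [List.mem_range] at hi
  have := h (i + 1) (by rw [mem_Icc]; omega)
  simp only [this]

theorem abMonomial_mul_a {n : ℕ} {S : Finset ℕ} (hS : S ⊆ Icc 1 n) :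
    abMonomial n S * AB.a.poly = abMonomial (n + 1) S := by
  have : n + 1 ∉ S := fun h => by have := mem_Icc.1 (hS h); omega
  rw [abMonomial, abMonomial, abWord_succ, if_neg this, map_mul]
  rfl

theorem abMonomial_mul_b {n : ℕ} {S : Finset ℕ} :
    abMonomial n S * AB.b.poly = abMonomial (n + 1) (insert (n + 1) S) := by
  rw [abMonomial, abMonomial, abWord_succ, if_pos (mem_insert_self _ _), map_mul]
  rw [abWord_congr (S := S) (S' := insert (n + 1) S)]
  · rfl
  · intro i hi
    rw [mem_Icc] at hi
    rw [mem_insert]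
    have : i ≠ n + 1 := by omega
    tauto

theorem abWord_injOn {n : ℕ} {S S' : Finset ℕ} (hS : S ⊆ Icc 1 n) (hS' : S' ⊆ Icc 1 n)
    (h : abWord n S = abWord n S') : S = S' := by
  have h1 : ∀ i < n, (i + 1 ∈ S ↔ i + 1 ∈ S') := by
    intro i hi
    have h2 := congrArg FreeMonoid.toList h
    simp only [abWord, FreeMonoid.toList_ofList, List.map_inj_left, List.mem_range] at h2
    have h3 := h2 i hi
    split_ifs at h3 <;> tauto
  ext x
  have key : x ∈ Icc 1 n → (x ∈ S ↔ x ∈ S') := by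
    intro hx
    rw [mem_Icc] at hx
    have := h1 (x - 1) (by omega)
    rwa [Nat.sub_add_cancel hx.1] at this
  exact ⟨fun hx => (key (hS hx)).1 hx, fun hx => (key (hS' hx)).2 hx⟩

theorem eq_of_abWord_eq {n n' : ℕ} {S S' : Finset ℕ} (h : abWord n S = abWord n' S') :
    n = n' := by
  have h2 := congrArg (fun u => (FreeMonoid.toList u).length) h
  simpa [abWord] using h2

theorem coeff_abMonomial {n n' : ℕ} {S S' : Finset ℕ} (hS : S ⊆ Icc 1 n) (hS' : S' ⊆ Icc 1 n') :
    (abMonomial n' S').coeff (abWord n S) = if n' = n ∧ S' = S then 1 else 0 := by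
  classical
  rw [abMonomial, MonoidAlgebra.of_apply, MonoidAlgebra.coeff_single, Finsupp.single_apply]
  have : abWord n' S' = abWord n S ↔ n' = n ∧ S' = S := by
    constructor
    · intro h
      obtain rfl := eq_of_abWord_eq h
      exact ⟨rfl, abWord_injOn hS' hS h⟩
    · rintro ⟨rfl, rfl⟩
      rfl
  simp only [this]

theorem cdToAB_of_c : cdToAB (MonoidAlgebra.of ℤ _ (FreeMonoid.of CD.c)) =
    AB.a.poly + AB.b.poly := by
  rw [cdToAB, MonoidAlgebra.lift_of, FreeMonoid.lift_eval_of]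

theorem cdToAB_of_d : cdToAB (MonoidAlgebra.of ℤ _ (FreeMonoid.of CD.d)) =
    AB.a.poly * AB.b.poly + AB.b.poly * AB.a.poly := by
  rw [cdToAB, MonoidAlgebra.lift_of, FreeMonoid.lift_eval_of]

theorem xorInd_insert_of_notMem {R : Type*} [CommRing R] {X S : Finset ℕ} {j : ℕ}
    (hj : ∀ x ∈ X, x ≠ j ∧ x ≠ j + 1) (hX : 0 ∉ X) :
    xorInd R X (insert j S) = xorInd R X S := by
  simp only [xorInd]
  congr 1
  simp only [eq_iff_iff]
  refine forall₂_congr fun x hx => ?_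
  have h1 := hj x hx
  have h2 : x ≠ 0 := fun h => hX (h ▸ hx)
  have h3 : x - 1 ≠ j := by omega
  simp [h1.1, h3]

theorem Icc_one_succ (n : ℕ) : Icc 1 (n + 1) = insert (n + 1) (Icc 1 n) := by
  ext; simp only [mem_Icc, mem_insert]; omega

/-- A letter `d` ending at position `x` becomes `ab` or `ba` at positions `x - 1`, `x`, so exactly
one of these is `b`; a letter `c` imposes no condition at its position. -/
theorem cdToAB_of (w : CDWord) : cdToAB (MonoidAlgebra.of ℤ _ w) =
    ∑ S ∈ (Icc 1 (deg w)).powerset, xorInd ℤ (wordSet w) S • abMonomial (deg w) S := by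
  induction w using CDWord.induction_right with
  | one =>
    rw [deg_one, wordSet_one, map_one, map_one]
    simp [xorInd, abMonomial, abWord]
    rfl
  | mul_c w ih =>
    rw [map_mul, map_mul, ih, cdToAB_of_c, deg_mul_c, wordSet_mul_c, Icc_one_succ,
      sum_powerset_insert (by simp), ← sum_add_distrib, sum_mul]
    refine sum_congr rfl fun S hS => ?_
    rw [mem_powerset] at hS
    have hw : ∀ x ∈ wordSet w, 1 ≤ x ∧ x ≤ deg w := fun x hx => mem_Icc.1 (wordSet_subset w hx)
    rw [xorInd_insert_of_notMem (fun x hx => by have := hw x hx; omega)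
      (fun h => by have := hw 0 h; omega), smul_mul_assoc, mul_add, abMonomial_mul_a hS,
      abMonomial_mul_b, smul_add]
  | mul_d w ih =>
    have hw : ∀ x ∈ wordSet w, 1 ≤ x ∧ x ≤ deg w := fun x hx => mem_Icc.1 (wordSet_subset w hx)
    have h0 : 0 ∉ wordSet w := fun h => by have := hw 0 h; omega
    rw [map_mul, map_mul, ih, cdToAB_of_d, deg_mul_d, wordSet_mul_d, Icc_one_succ,
      sum_powerset_insert (by simp), Icc_one_succ, sum_powerset_insert (by simp),
      sum_powerset_insert (by simp), ← sum_add_distrib, ← sum_add_distrib, ← sum_add_distrib,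
      sum_mul]
    refine sum_congr rfl fun S hS => ?_
    rw [mem_powerset] at hS
    have hx : ∀ A : Finset ℕ, xorInd ℤ (insert (deg w + 2) (wordSet w)) A =
        if (deg w + 1 ∈ A ↔ deg w + 2 ∉ A) then xorInd ℤ (wordSet w) A else 0 := by
      intro A
      simp only [xorInd, forall_mem_insert]
      have : deg w + 2 - 1 = deg w + 1 := rfl
      rw [this]
      split_ifs <;> tauto
    have hS1 : deg w + 1 ∉ S := fun h => by have := mem_Icc.1 (hS h); omega
    have hS2 : deg w + 2 ∉ S := fun h => by have := mem_Icc.1 (hS h); omega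
    have e1 : ∀ A, xorInd ℤ (wordSet w) (insert (deg w + 1) A) = xorInd ℤ (wordSet w) A :=
      fun A => xorInd_insert_of_notMem (fun x hx => by have := hw x hx; omega) h0
    have e2 : ∀ A, xorInd ℤ (wordSet w) (insert (deg w + 2) A) = xorInd ℤ (wordSet w) A :=
      fun A => xorInd_insert_of_notMem (fun x hx => by have := hw x hx; omega) h0
    have hS' : insert (deg w + 1) S ⊆ Icc 1 (deg w + 1) := by
      rw [Icc_one_succ]
      exact insert_subset_insert _ hS
    have hS'' : S ⊆ Icc 1 (deg w + 1) := hS.trans (Icc_subset_Icc_right (Nat.le_succ _))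
    simp only [show deg w + 1 + 1 = deg w + 2 from rfl, hx, mem_insert, hS1, hS2, e1, e2]
    rw [smul_mul_assoc, mul_add, ← mul_assoc, ← mul_assoc, abMonomial_mul_a hS,
      abMonomial_mul_b, abMonomial_mul_b, abMonomial_mul_a hS', smul_add]
    simp
    abel

theorem coeff_cdToAB {n : ℕ} {S : Finset ℕ} (hS : S ⊆ Icc 1 n) (ψ : MonoidAlgebra ℤ CDWord) :
    (cdToAB ψ).coeff (abWord n S) =
      ∑ w ∈ wordsOfDeg n, ψ.coeff w * xorInd ℤ (wordSet w) S := by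
  classical
  induction ψ using MonoidAlgebra.induction_linear with
  | zero => simp
  | add φ ψ hφ hψ =>
    rw [map_add, MonoidAlgebra.coeff_add, Finsupp.add_apply, hφ, hψ, ← sum_add_distrib]
    refine sum_congr rfl fun w _ => ?_
    rw [MonoidAlgebra.coeff_add, Finsupp.add_apply, add_mul]
  | single v r =>
    have hv : MonoidAlgebra.single v r = r • MonoidAlgebra.of ℤ CDWord v := by
      rw [MonoidAlgebra.of_apply, MonoidAlgebra.smul_single, smul_eq_mul, mul_one]
    rw [MonoidAlgebra.coeff_single]
    simp only [Finsupp.single_apply, ite_mul, zero_mul]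
    rw [sum_ite_eq, hv, map_smul, MonoidAlgebra.coeff_smul, Finsupp.smul_apply, cdToAB_of,
      MonoidAlgebra.coeff_sum, Finsupp.finsetSum_apply]
    have h1 : ∀ S' ∈ (Icc 1 (deg v)).powerset,
        (xorInd ℤ (wordSet v) S' • abMonomial (deg v) S').coeff (abWord n S) =
          if deg v = n ∧ S' = S then xorInd ℤ (wordSet v) S' else 0 := by
      intro S' hS'
      rw [MonoidAlgebra.coeff_smul, Finsupp.smul_apply,
        coeff_abMonomial hS (mem_powerset.1 hS'), smul_eq_mul, mul_ite, mul_one, mul_zero]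
    rw [sum_congr rfl h1]
    by_cases h : deg v = n
    · subst h
      simp [hS]
    · simp [h]

/-- If the image vanishes, the coefficients of `ψ` in each degree expand the zero function, and such
expansions are unique. -/
theorem cdToAB_injective : Function.Injective cdToAB := by
  rw [injective_iff_map_eq_zero]
  intro ψ hψ
  rw [← MonoidAlgebra.coeff_eq_zero]
  ext w
  have h : IsFlagF (deg w) ψ.coeff (0 : Finset ℕ → ℤ) := by
    refine isFlagF_of_moebius_eq fun S hS => ?_
    rw [← coeff_cdToAB hS, hψ]
    simp [moebius]
  have h3 : IsFlagF (deg w) (0 : CDWord → ℤ) (0 : Finset ℕ → ℤ) := fun T _ => by simp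
  exact h.eq_on h3 (fun _ _ => rfl) rfl

theorem IsFlagF.cdToAB_sum {n : ℕ} {κ : CDWord → ℤ} {f : Finset ℕ → ℤ} (h : IsFlagF n κ f) :
    cdToAB (∑ w ∈ wordsOfDeg n, κ w • MonoidAlgebra.of ℤ CDWord w) =
      ∑ S ∈ (Icc 1 n).powerset, moebius f S • abMonomial n S := by
  have h1 : ∀ S ∈ (Icc 1 n).powerset, moebius f S • abMonomial n S =
      ∑ w ∈ wordsOfDeg n, κ w • xorInd ℤ (wordSet w) S • abMonomial n S := by
    intro S hS
    rw [h.moebius_eq (mem_powerset.1 hS), sum_smul]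
    exact sum_congr rfl fun w _ => mul_smul _ _ _
  rw [sum_congr rfl h1, sum_comm, map_sum]
  refine sum_congr rfl fun w hw => ?_
  rw [mem_wordsOfDeg] at hw
  subst hw
  rw [map_smul, cdToAB_of, smul_sum]

theorem coeff_sum_abMonomial {n n' : ℕ} (f : Finset ℕ → ℤ) {S : Finset ℕ} (hS : S ⊆ Icc 1 n') :
    (∑ S' ∈ (Icc 1 n).powerset, f S' • abMonomial n S').coeff (abWord n' S) =
      if n = n' then f S else 0 := by
  rw [MonoidAlgebra.coeff_sum, Finsupp.finsetSum_apply]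
  have h1 : ∀ S' ∈ (Icc 1 n).powerset, (f S' • abMonomial n S').coeff (abWord n' S) =
      if n = n' ∧ S' = S then f S' else 0 := by
    intro S' hS'
    rw [MonoidAlgebra.coeff_smul, Finsupp.smul_apply,
      coeff_abMonomial hS (mem_powerset.1 hS'), smul_eq_mul, mul_ite, mul_one, mul_zero]
  rw [sum_congr rfl h1]
  by_cases h : n = n'
  · subst h
    simp [hS]
  · simp [h]

/-! ### Eulerian posets -/

theorem finite_of_boundedOrder {P : Type*} [PartialOrder P] [BoundedOrder P]
    [LocallyFiniteOrder P] : Finite P :=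
  Set.finite_univ_iff.1 ((Finset.Icc (⊥ : P) ⊤).finite_toSet.subset fun x _ => by simp)

section Poset

variable {P : Type*} [PartialOrder P] [GradeMinOrder ℕ P]

/-- Up to the sign `(-1) ^ grade ℕ x` the summands are the values `μ(x, z)`, whose sum over a
nontrivial interval is zero. -/
theorem IsEulerian.sum_Icc_neg_one_pow_grade [LocallyFiniteOrder P] [DecidableEq P]
    (h : IsEulerian P) {x y : P} (hxy : x < y) : ∑ z ∈ Icc x y, (-1 : ℤ) ^ grade ℕ z = 0 := by
  have h1 : ∀ z ∈ Icc x y,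
      (-1 : ℤ) ^ grade ℕ z = (-1) ^ grade ℕ x * IncidenceAlgebra.mu ℤ x z := by
    intro z hz
    rw [mem_Icc] at hz
    rw [h x z hz.1, ← pow_add, Nat.add_sub_cancel' (grade_mono hz.1)]
  rw [sum_congr rfl h1, ← mul_sum, IncidenceAlgebra.sum_Icc_mu_right, if_neg hxy.ne, mul_zero]

theorem le_of_grade_le_of_isChain {C : Set P} (hC : IsChain (· ≤ ·) C) {a b : P} (ha : a ∈ C)
    (hb : b ∈ C) (h : grade ℕ a ≤ grade ℕ b) : a ≤ b := by
  rcases hC.total ha hb with h1 | h1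
  · exact h1
  · rcases h1.eq_or_lt with rfl | h2
    · exact le_rfl
    · exact absurd (grade_strictMono (𝕆 := ℕ) h2) (not_lt.2 h)

variable (P) in
open scoped Classical in
/-- The chains whose elements have precisely the ranks in `S`. -/
noncomputable def chainsOfRank [Fintype P] (S : Finset ℕ) : Finset (Finset P) :=
  univ.filter fun C => IsChain (· ≤ ·) (C : Set P) ∧ C.image (grade ℕ) = S

theorem mem_chainsOfRank [Fintype P] {S : Finset ℕ} {C : Finset P} : C ∈ chainsOfRank P S ↔
    IsChain (· ≤ ·) (C : Set P) ∧ C.image (grade ℕ) = S := by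
  simp [chainsOfRank]

theorem posetFlagF_eq_card [Fintype P] (S : Finset ℕ) :
    posetFlagF P S = #(chainsOfRank P S) := by
  rw [posetFlagF, ← Set.ncard_coe_finset]
  congr 2
  ext C
  rw [mem_coe, mem_chainsOfRank, Set.mem_ofPred_eq]

/-- Chains with ranks in `T ∪ {j}` arise from chains with ranks in `T` by adding an element between
the elements of the adjacent ranks `i < j < k`. -/
theorem card_chainsOfRank_insert [BoundedOrder P] [Fintype P] [DecidableEq P] [LocallyFiniteOrder P]
    {n : ℕ} {T : Finset ℕ} {i j k : ℕ} (hP : grade ℕ (⊤ : P) = n + 1) (hT : T ⊆ Icc 1 n)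
    (hij : i < j) (hjk : j < k) (hgap : ∀ t ∈ T, ¬ (i < t ∧ t < k)) {x y : Finset P → P}
    (hx : ∀ C ∈ chainsOfRank P T, grade ℕ (x C) = i ∧ (x C = ⊥ ∨ x C ∈ C))
    (hy : ∀ C ∈ chainsOfRank P T, grade ℕ (y C) = k ∧ (y C = ⊤ ∨ y C ∈ C)) :
    #(chainsOfRank P (insert j T)) =
      ∑ C ∈ chainsOfRank P T, #{z ∈ Icc (x C) (y C) | grade ℕ z = j} := by
  classical
  have hjT : j ∉ T := fun h => hgap j h ⟨hij, hjk⟩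
  -- The chains are grouped by what remains after deleting the element of rank `j`.
  rw [card_eq_sum_card_fiberwise (f := fun C => C.filter fun z => grade ℕ z ≠ j)
    (t := chainsOfRank P T)]
  · refine sum_congr rfl fun C hC => ?_
    obtain ⟨hxi, hxC⟩ := hx C hC
    obtain ⟨hyk, hyC⟩ := hy C hC
    obtain ⟨hch, himg⟩ := mem_chainsOfRank.1 hC
    have hCT : ∀ c ∈ C, grade ℕ c ∈ T := fun c hc => himg ▸ mem_image_of_mem _ hc
    symm
    refine card_bij (fun z _ => insert z C) ?_ ?_ ?_
    · intro z hz
      rw [mem_filter, mem_Icc] at hz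
      obtain ⟨⟨hxz, hzy⟩, hzj⟩ := hz
      rw [mem_filter, mem_chainsOfRank]
      refine ⟨⟨?_, by rw [image_insert, himg, hzj]⟩, ?_⟩
      · rw [coe_insert]
        refine hch.insert fun c hc _ => ?_
        have hcT := hCT c hc
        have hcn := mem_Icc.1 (hT hcT)
        have hcg := hgap _ hcT
        by_cases hci : grade ℕ c ≤ i
        · right
          refine le_trans ?_ hxz
          rcases hxC with hb | hxC
          · rw [hb, grade_bot, Nat.bot_eq_zero] at hxi
            omega
          · exact le_of_grade_le_of_isChain hch hc hxC (by omega)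
        · left
          refine hzy.trans ?_
          rcases hyC with hb | hyC
          · rw [hb, hP] at hyk
            omega
          · exact le_of_grade_le_of_isChain hch hyC hc (by omega)
      · rw [filter_insert, if_neg (by simpa using hzj), filter_eq_self]
        intro c hc h
        exact hjT (h ▸ hCT c hc)
    · intro z hz z' hz' h
      rw [mem_filter] at hz
      have h1 : z ∈ insert z' C := h ▸ mem_insert_self z C
      rw [mem_insert] at h1
      exact h1.resolve_right fun h2 => hjT (hz.2 ▸ hCT z h2)
    · intro D hD
      rw [mem_filter, mem_chainsOfRank] at hD
      obtain ⟨⟨hDch, hDimg⟩, hDC⟩ := hD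
      have hCD : C ⊆ D := hDC ▸ filter_subset _ _
      obtain ⟨z, hzD, hzj⟩ := mem_image.1 (hDimg.symm ▸ mem_insert_self j T : j ∈ D.image _)
      refine ⟨z, ?_, ?_⟩
      · rw [mem_filter, mem_Icc]
        refine ⟨⟨?_, ?_⟩, hzj⟩
        · rcases hxC with hb | hxC
          · rw [hb]; exact bot_le
          · exact le_of_grade_le_of_isChain hDch (hCD hxC) hzD (by omega)
        · rcases hyC with hb | hyC
          · rw [hb]; exact le_top
          · exact le_of_grade_le_of_isChain hDch hzD (hCD hyC) (by omega)
      · refine subset_antisymm (insert_subset hzD hCD) fun c hc => ?_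
        rw [mem_insert]
        by_cases hcj : grade ℕ c = j
        · left
          exact le_antisymm (le_of_grade_le_of_isChain hDch hc hzD (by omega))
            (le_of_grade_le_of_isChain hDch hzD hc (by omega))
        · right
          rw [← hDC, mem_filter]
          exact ⟨hc, hcj⟩
  · intro D hD
    rw [mem_coe, mem_chainsOfRank] at hD
    rw [mem_coe, mem_chainsOfRank]
    refine ⟨hD.1.mono (by rw [coe_subset]; exact filter_subset _ _), ?_⟩
    ext t
    have ht : t ∈ D.image (grade ℕ) ↔ t = j ∨ t ∈ T := by rw [hD.2, mem_insert]
    simp only [mem_image, mem_filter] at ht ⊢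
    constructor
    · rintro ⟨z, ⟨hz, hzj⟩, rfl⟩
      exact (ht.1 ⟨z, hz, rfl⟩).resolve_left hzj
    · intro htT
      obtain ⟨z, hz, rfl⟩ := ht.2 (Or.inr htT)
      exact ⟨z, ⟨hz, fun h => hjT (h ▸ htT)⟩, rfl⟩

/-- A chain with ranks `T`, completed by `⊥` and `⊤`, has elements `x < y` at the adjacent ranks `i
< k`. Its extensions by rank `j` correspond to the elements of rank `j` in `[x, y]`, so the relation
is a sum of alternating rank sums of intervals. For `j = i` and `j = k` there is just one such
element, `x` or `y`, in accordance with the terms `f_T`. -/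
theorem IsEulerian.dehnSommerville [BoundedOrder P] [LocallyFiniteOrder P] [DecidableEq P]
    (h : IsEulerian P) {n : ℕ} (hP : grade ℕ (⊤ : P) = n + 1) :
    DehnSommerville n (posetFlagF P) := by
  classical
  have := finite_of_boundedOrder (P := P)
  let _ := Fintype.ofFinite P
  intro T hT i k hik hk hi hk' hgap
  have hxy : ∀ C : Finset P, ∃ x y : P, C ∈ chainsOfRank P T →
      (grade ℕ x = i ∧ (x = ⊥ ∨ x ∈ C)) ∧ (grade ℕ y = k ∧ (y = ⊤ ∨ y ∈ C)) := by
    intro C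
    by_cases hC : C ∈ chainsOfRank P T
    · obtain ⟨-, himg⟩ := mem_chainsOfRank.1 hC
      have h1 : ∃ x : P, grade ℕ x = i ∧ (x = ⊥ ∨ x ∈ C) := by
        rcases hi with rfl | hi
        · exact ⟨⊥, by simp, Or.inl rfl⟩
        · rw [← himg] at hi
          obtain ⟨x, hx, hxi⟩ := mem_image.1 hi
          exact ⟨x, hxi, Or.inr hx⟩
      have h2 : ∃ y : P, grade ℕ y = k ∧ (y = ⊤ ∨ y ∈ C) := by
        rcases hk' with rfl | hk'
        · exact ⟨⊤, hP, Or.inl rfl⟩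
        · rw [← himg] at hk'
          obtain ⟨y, hy, hyk⟩ := mem_image.1 hk'
          exact ⟨y, hyk, Or.inr hy⟩
      obtain ⟨x, hx⟩ := h1
      obtain ⟨y, hy⟩ := h2
      exact ⟨x, y, fun _ => ⟨hx, hy⟩⟩
    -- Arbitrary values, so that `x` and `y` become total functions on finsets.
    · exact ⟨⊥, ⊥, fun h => absurd h hC⟩
  choose x y hxy using hxy
  have hlt : ∀ C ∈ chainsOfRank P T, x C < y C := by
    intro C hC
    obtain ⟨⟨hx, hx'⟩, hy, hy'⟩ := hxy C hC
    have hle : x C ≤ y C := by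
      rcases hx' with h1 | h1
      · rw [h1]; exact bot_le
      · rcases hy' with h2 | h2
        · rw [h2]; exact le_top
        · exact le_of_grade_le_of_isChain (mem_chainsOfRank.1 hC).1 h1 h2 (by omega)
    refine hle.lt_of_ne fun h => ?_
    rw [h] at hx
    omega
  have hcount : ∀ j ∈ Icc i k, posetFlagF P (insert j T ∩ Icc 1 n) =
      ∑ C ∈ chainsOfRank P T, (#{z ∈ Icc (x C) (y C) | grade ℕ z = j} : ℤ) := by
    intro j hj
    rw [mem_Icc] at hj
    have hend : insert j T ∩ Icc 1 n = T →
        (∀ C ∈ chainsOfRank P T, #{z ∈ Icc (x C) (y C) | grade ℕ z = j} = 1) →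
        posetFlagF P (insert j T ∩ Icc 1 n) =
        ∑ C ∈ chainsOfRank P T, (#{z ∈ Icc (x C) (y C) | grade ℕ z = j} : ℤ) := by
      intro h1 h2
      rw [h1, posetFlagF_eq_card, sum_congr rfl fun C hC => by rw [h2 C hC]]
      simp
    rcases hj.1.eq_or_lt with rfl | hij
    · refine hend ?_ fun C hC => ?_
      · rcases hi with rfl | hi
        · ext z
          have := @hT z
          simp only [mem_inter, mem_insert, mem_Icc] at *
          constructor
          · rintro ⟨h | h, _⟩
            · omega
            · exact h
          · tauto
        · rw [insert_eq_self.2 hi, inter_eq_left.2 hT]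
      · rw [card_eq_one]
        refine ⟨x C, ?_⟩
        ext z
        rw [mem_filter, mem_Icc, mem_singleton]
        constructor
        · rintro ⟨⟨h1, -⟩, h2⟩
          by_contra hne
          have := grade_strictMono (𝕆 := ℕ) (h1.lt_of_ne' hne)
          have := (hxy C hC).1.1
          omega
        · rintro rfl
          exact ⟨⟨le_rfl, (hlt C hC).le⟩, (hxy C hC).1.1⟩
    rcases hj.2.eq_or_lt with rfl | hjk
    · refine hend ?_ fun C hC => ?_
      · rcases hk' with rfl | hk'
        · ext z
          have := @hT z
          simp only [mem_inter, mem_insert, mem_Icc] at *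
          constructor
          · rintro ⟨h | h, _⟩
            · omega
            · exact h
          · tauto
        · rw [insert_eq_self.2 hk', inter_eq_left.2 hT]
      · rw [card_eq_one]
        refine ⟨y C, ?_⟩
        ext z
        rw [mem_filter, mem_Icc, mem_singleton]
        constructor
        · rintro ⟨⟨-, h1⟩, h2⟩
          by_contra hne
          have := grade_strictMono (𝕆 := ℕ) (h1.lt_of_ne hne)
          have := (hxy C hC).2.1
          omega
        · rintro rfl
          exact ⟨⟨(hlt C hC).le, le_rfl⟩, (hxy C hC).2.1⟩
    · have : insert j T ⊆ Icc 1 n := insert_subset (by rw [mem_Icc]; omega) hT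
      rw [inter_eq_left.2 this, posetFlagF_eq_card, card_chainsOfRank_insert hP hT hij hjk hgap
        (fun C hC => (hxy C hC).1) (fun C hC => (hxy C hC).2)]
      push_cast
      rfl
  rw [sum_congr rfl fun j hj => by rw [hcount j hj, mul_sum], sum_comm]
  refine sum_eq_zero fun C hC => ?_
  -- The alternating sum over the interval, regrouped by rank.
  rw [← h.sum_Icc_neg_one_pow_grade (hlt C hC),
    ← sum_fiberwise_of_maps_to (s := Icc (x C) (y C)) (t := Icc i k) (g := grade ℕ)]
  · refine sum_congr rfl fun j _ => ?_
    rw [sum_congr rfl fun z hz => by rw [(mem_filter.1 hz).2], sum_const, nsmul_eq_mul, mul_comm]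
  · intro z hz
    rw [mem_Icc] at hz ⊢
    have h1 := grade_mono (𝕆 := ℕ) hz.1
    have h2 := grade_mono (𝕆 := ℕ) hz.2
    have := hxy C hC
    omega

variable {n : ℕ}

theorem IsEulerian.existsUnique_isPosetCDIndex [BoundedOrder P] [LocallyFiniteOrder P]
    [DecidableEq P] (h : IsEulerian P) (hP : grade ℕ (⊤ : P) = n + 1) :
    ∃! ψ : MonoidAlgebra ℤ CDWord, IsPosetCDIndex P n ψ := by
  obtain ⟨κ, hκ⟩ := (h.dehnSommerville hP).exists_isFlagF
  exact ⟨_, hκ.cdToAB_sum, fun ψ hψ => cdToAB_injective (hψ.trans hκ.cdToAB_sum.symm)⟩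

/-- The case `n ≠ n'` records that `ψ` has no terms outside degree `n`, so comparison with `F(P)` is
possible in all degrees at once. -/
theorem IsPosetCDIndex.isFlagF {ψ : MonoidAlgebra ℤ CDWord} (hψ : IsPosetCDIndex P n ψ) (n' : ℕ) :
    IsFlagF n' ψ.coeff (if n = n' then posetFlagF P else 0) := by
  refine isFlagF_of_moebius_eq fun S hS => ?_
  rw [← coeff_cdToAB hS, hψ]
  change _ = (∑ S' ∈ (Icc 1 n).powerset, posetFlagH P S' • abMonomial n S').coeff _
  rw [coeff_sum_abMonomial _ hS]
  split_ifs
  · rfl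
  · simp [moebius]

theorem flagF_posetQSym {n' : ℕ} {T : Finset ℕ} (hT : T ⊆ Icc 1 n') :
    flagF (posetQSym P n) n' T = ((if n = n' then posetFlagF P else 0) T : ℤ) := by
  have h1 : flagF (posetQSym P n) n' T =
      ∑ S ∈ (Icc 1 n).powerset, (posetFlagF P S : ℚ) * flagF (M n S) n' T := by
    rw [flagF, posetQSym, map_sum]
    exact sum_congr rfl fun S _ => MvPowerSeries.coeff_smul _ _ _
  rw [h1]
  split_ifs with h
  · subst h
    rw [sum_congr rfl fun S hS => by rw [flagF_M hT (mem_powerset.1 hS)]]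
    simp [hT]
  · rw [sum_eq_zero]
    · simp
    · intro S hS
      rw [flagF, coeff_M_of_degree_ne (mem_powerset.1 hS), mul_zero]
      rw [degree_toFinsupp_comp hT]
      omega

theorem posetQSym_mem_quasiSymm : posetQSym P n ∈ quasiSymm :=
  sum_mem fun S _ => Subalgebra.smul_mem _ (M_mem_quasiSymm n S) _

theorem constantCoeff_posetQSym : MvPowerSeries.constantCoeff (posetQSym P n) = 0 := by
  rw [posetQSym, map_sum]
  refine sum_eq_zero fun S hS => ?_
  rw [MvPowerSeries.constantCoeff_smul, ← MvPowerSeries.coeff_zero_eq_constantCoeff_apply,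
    coeff_M_of_degree_ne (mem_powerset.1 hS) (by simp), smul_zero]

theorem IsFlagF.intCast {n : ℕ} {κ : CDWord → ℤ} {f : Finset ℕ → ℤ} (h : IsFlagF n κ f) :
    IsFlagF n (fun w => (κ w : ℚ)) (fun T => (f T : ℚ)) := by
  intro T hT
  simp only [h T hT, xorInd]
  push_cast
  rfl

theorem IsPosetCDIndex.posetQSym_eq {ψ : MonoidAlgebra ℤ CDWord} (hψ : IsPosetCDIndex P n ψ) :
    posetQSym P n =
      ∑ w ∈ ψ.coeff.support, ((ψ.coeff w : ℚ) / 2 ^ (dDeg w + 1)) • theta w := by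
  refine quasiSymm_ext posetQSym_mem_quasiSymm (sum_smul_theta_mem_quasiSymm _ _) ?_
    fun n' T hT => ?_
  · rw [constantCoeff_posetQSym, constantCoeff_sum_smul_theta]
  · rw [flagF_posetQSym hT, isFlagF_sum_theta ψ.coeff.support (fun w => (ψ.coeff w : ℚ))
        (fun w hw => by rw [Finsupp.notMem_support_iff.1 hw, Int.cast_zero]) n' T hT]
    exact (hψ.isFlagF n').intCast T hT

end Poset

end PeakCD

theorem theorem2 :
    -- the `Θ_w` are linearly independent elements of the peak algebra
    (LinearIndependent ℚ theta ∧ ∀ w, theta w ∈ peakAlgebra) ∧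
    -- every `F` in the peak algebra has a well-defined `cd`-index
    (∀ F ∈ peakAlgebra, ∃! κ : CDWord → ℚ, IsCDIndex F κ) ∧
    -- and `F = ½ ∑ [[w]] Θ_w`, a finite sum, if `F` has no constant term
    (∀ F ∈ peakAlgebra, MvPowerSeries.constantCoeff F = 0 →
      ∀ κ : CDWord → ℚ, IsCDIndex F κ →
        (Function.support (c2dCoeff κ)).Finite ∧
          F = (1 / 2 : ℚ) • ∑ᶠ w, c2dCoeff κ w • theta w) ∧
    -- Eulerian posets of rank `n + 1`
    (∀ (P : Type*) [PartialOrder P] [BoundedOrder P] [GradeMinOrder ℕ P]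
      [LocallyFiniteOrder P] [DecidableEq P] (n : ℕ),
      grade ℕ (⊤ : P) = n + 1 → IsEulerian P →
        (∃! ψ : MonoidAlgebra ℤ CDWord, IsPosetCDIndex P n ψ) ∧
        ∀ ψ : MonoidAlgebra ℤ CDWord, IsPosetCDIndex P n ψ →
          posetQSym P n =
            ∑ w ∈ ψ.coeff.support, ((ψ.coeff w : ℚ) / 2 ^ (dDeg w + 1)) • theta w) := by
  refine ⟨⟨linearIndependent_theta, theta_mem_peakAlgebra⟩, fun F hF => existsUnique_isCDIndex hF,
    fun F hF h0 κ hκ => eq_sum_theta hF h0 hκ, ?_⟩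
  intro P _ _ _ _ _ n hP hE
  exact ⟨hE.existsUnique_isPosetCDIndex hP, fun ψ hψ => hψ.posetQSym_eq⟩
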